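/- Let $\theta,\varepsilon'$ be real numbers with $0<\varepsilon'$ and $3\varepsilon'\le\theta<1$ (for instance $\theta=1-10^{-10^{10}}$, $\varepsilon'=10^{-10}(1-\theta)$). Write $\hat f(\xi)=\int_{\mathbb R}e^{-2\pi i x\xi}f(x)\,dx$, and let $\mathcal S'/\mathcal P$ be the space of complex tempered distributions on $\mathbb R$ modulo polynomials. For $\sigma>0$ let $\Lambda^\sigma$ be the Fourier multiplier with symbol $|\xi|^\sigma$, let $K(t,\cdot)=\mathcal F^{-1}(e^{-t|\xi|/4})$, i.e. $K(t,x)=\frac{8t}{t^2+64\pi^2x^2}$, for $t>0$, and let $\delta_\alpha f(x)=f(x)-f(x-\alpha)$. For $h\in\mathcal S'/\mathcal P$ put $$\|h\|_{\tilde{\mathcal G}}=\sup_{\substack{0\le\mu\le 2/3\\ 2\varepsilon'\le b\le\theta-\mu-\varepsilon'}}\ \inf_{F}\ \sup_{\alpha\in\mathbb R\setminus\{0\}}\frac{\big\|t^\mu\,\delta_\alpha F\big\|_{L^{1/b}_t((0,\infty);L^\infty(\mathbb R))}}{|\alpha|^{\mu+\varepsilon'}} ,$$ where, for given $b$, the infimum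 runs over the families $F=(F(t,\cdot))_{t>0}$ of functions on $\mathbb R$ that define tempered distributions by integration (absolutely convergent against every Schwartz function) and represent $\Lambda^{b-\varepsilon'}(K(t,\cdot)*h)$ modulo polynomials, i.e. $\widehat{F(t,\cdot)}(\xi)=|\xi|^{b-\varepsilon'}e^{-t|\xi|/4}\,\hat h(\xi)$ as distributions on $\mathbb R\setminus\{0\}$; it is $+\infty$ if there is no such family. Let $\tilde{\mathcal G}=\{h\in\mathcal S'/\mathcal P:\|h\|_{\tilde{\mathcal G}}<\infty\}$. Let $\phi:\mathbb R\to\mathbb R$ be a smooth function with compact support in $\mathbb R\setminus\{0\}$ such that $\sum_{j\in\mathbb Z}\phi(2^{-j}\xi)=1$ for all $\xi\ne0$, and let $$\|h\|_{\dot B^0_{\infty,\infty}}=\sup_{j\in\mathbb Z}\big\|\mathcal F^{-1}\big(\phi(2^{-j}\cdot)\hat h\big)\big\|_{L^\infty(\mathbb R)},\qquad \dot B^0_{\infty,\infty}=\{h\in\mathcal S'/\mathcal P:\|h\|_{\dot B^0_{\infty,\infty}}<\infty\}.$$ Then $\tilde{\mathcal G}=\dot B^0_{\infty,\infty}$ with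 equivalent norms: there is a constant $C>0$, depending only on $\theta,\varepsilon',\phi$, such that for every $h\in\mathcal S'/\mathcal P$ $$\|h\|_{\tilde{\mathcal G}}\le C\,\|h\|_{\dot B^0_{\infty,\infty}}\quad\text{and}\quad \|h\|_{\dot B^0_{\infty,\infty}}\le C\,\|h\|_{\tilde{\mathcal G}} .$$ -/

import Mathlib

open MeasureTheory Set
open scoped SchwartzMap ENNReal NNReal ContDiff

noncomputable section

/-- The tempered distribution `u` is given by the function `F`: `u(φ) = ∫ φ F` for all Schwartz `φ`
(all these integrals being absolutely convergent). -/
def IsGivenBy (u : 𝓢'(ℝ, ℂ)) (F : ℝ → ℂ) : Prop :=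
  ∀ φ : 𝓢(ℝ, ℂ), Integrable (fun x : ℝ => φ x * F x) ∧ u φ = ∫ x : ℝ, φ x * F x

/-- The polynomials, as a subspace of the tempered distributions on `ℝ`. -/
def polynomialDistributions : Submodule ℂ 𝓢'(ℝ, ℂ) where
  carrier := {u | ∃ p : Polynomial ℂ, IsGivenBy u (fun x : ℝ => p.eval (x : ℂ))}
  zero_mem' := ⟨0, fun φ => by simp⟩
  add_mem' := by
    rintro u v ⟨p, hp⟩ ⟨q, hq⟩
    refine ⟨p + q, fun φ => ?_⟩
    simp only [Polynomial.eval_add, mul_add]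
    refine ⟨(hp φ).1.add (hq φ).1, ?_⟩
    rw [integral_add (hp φ).1 (hq φ).1, ← (hp φ).2, ← (hq φ).2]
    rfl
  smul_mem' := by
    rintro c u ⟨p, hp⟩
    refine ⟨c • p, fun φ => ?_⟩
    simp only [Polynomial.eval_smul, smul_eq_mul, mul_left_comm _ c]
    refine ⟨(hp φ).1.const_mul c, ?_⟩
    rw [integral_const_mul, ← (hp φ).2]
    rfl

/-- Tempered distributions on `ℝ` modulo polynomials: the ambient space of homogeneous function
spaces. -/
abbrev TemperedModPoly : Type := 𝓢'(ℝ, ℂ) ⧸ polynomialDistributions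

/-- The extended `L^∞` norm of a tempered distribution: the essential supremum of the function it is
given by, and `∞` if it is not given by a function. -/
def supNorm (u : 𝓢'(ℝ, ℂ)) : ℝ≥0∞ :=
  ⨅ (g : ℝ → ℂ) (_ : IsGivenBy u g), eLpNorm g ⊤ volume

/-! ### The homogeneous Besov space -/

/-- A (homogeneous, dyadic) Littlewood–Paley function: smooth, compactly supported in `ℝ ∖ {0}`,
with `∑_{j ∈ ℤ} ϕ(2^{-j} ξ) = 1` for `ξ ≠ 0`. -/
structure IsLittlewoodPaley (ϕ : ℝ → ℝ) : Prop where
  contDiff : ContDiff ℝ ∞ ϕ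
  hasCompactSupport : HasCompactSupport ϕ
  zero_notMem : (0 : ℝ) ∉ tsupport ϕ
  hasSum_one : ∀ ξ : ℝ, ξ ≠ 0 → HasSum (fun j : ℤ => ϕ ((2 : ℝ) ^ (-j) * ξ)) 1

/-- The dyadic block `Δ_j h = 𝓕⁻¹ (ϕ(2^{-j} ·) 𝓕 h)`. -/
def dyadicBlock (ϕ : ℝ → ℝ) (j : ℤ) (h : 𝓢'(ℝ, ℂ)) : 𝓢'(ℝ, ℂ) :=
  TemperedDistribution.fourierMultiplierCLM ℂ (fun ξ : ℝ => (ϕ ((2 : ℝ) ^ (-j) * ξ) : ℂ)) h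

/-- `sup_j ‖Δ_j h‖_{L^∞}` for a tempered distribution `h`. It does not change when a polynomial is
added to `h`. -/
def besovNormRep (ϕ : ℝ → ℝ) (h : 𝓢'(ℝ, ℂ)) : ℝ≥0∞ :=
  ⨆ j : ℤ, supNorm (dyadicBlock ϕ j h)

/-- The norm of `Ḃ⁰_{∞,∞}` of a class modulo polynomials, with value `∞` outside the space. -/
def besovNorm (ϕ : ℝ → ℝ) (x : TemperedModPoly) : ℝ≥0∞ :=
  ⨅ (h : 𝓢'(ℝ, ℂ)) (_ : polynomialDistributions.mkQ h = x), besovNormRep ϕ h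

/-- The homogeneous Besov space `Ḃ⁰_{∞,∞}(ℝ)`. -/
def besovSpace (ϕ : ℝ → ℝ) : Set TemperedModPoly := {x | besovNorm ϕ x < ⊤}

/-! ### The space `𝒢̃` -/

/-- The Fourier symbol `|ξ|^σ e^{-t|ξ|/4}` of `f ↦ Λ^σ (K(t,·) ∗ f)`. Here `Λ^σ` has symbol `|ξ|^σ`
and `K(t,·) = 𝓕⁻¹ (e^{-t|ξ|/4})`, that is, `K(t,x) = 8t / (t² + 64π²x²)` (Mathlib's Fourier
transform is `𝓕 f ξ = ∫ e^{-2πixξ} f x`). -/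
def poissonSymbol (σ t ξ : ℝ) : ℝ := |ξ| ^ σ * Real.exp (-(t * |ξ|) / 4)

/-- The function `F` is `Λ^σ (K(t,·) ∗ h)` modulo polynomials, for a tempered distribution `h`:
`F` is a tempered distribution and `𝓕 F = |ξ|^σ e^{-t|ξ|/4} 𝓕 h` as distributions on `ℝ ∖ {0}`,
i.e. after multiplication by any smooth `χ` with compact support in `ℝ ∖ {0}`. -/
def IsFracPoisson (σ t : ℝ) (h : 𝓢'(ℝ, ℂ)) (F : ℝ → ℂ) : Prop :=
  ∃ u : 𝓢'(ℝ, ℂ), IsGivenBy u F ∧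
    ∀ χ : ℝ → ℂ, ContDiff ℝ ∞ χ → HasCompactSupport χ → (0 : ℝ) ∉ tsupport χ →
      TemperedDistribution.fourierMultiplierCLM ℂ χ u =
        TemperedDistribution.fourierMultiplierCLM ℂ
          (fun ξ : ℝ => χ ξ * (poissonSymbol σ t ξ : ℂ)) h

/-- `δ_α f (x) = f(x) - f(x - α)`. -/
def increment (α : ℝ) (f : ℝ → ℂ) (x : ℝ) : ℂ := f x - f (x - α)

/-- The mixed norm `‖ t^μ δ_α F ‖_{L^{1/b}((0,∞); L^∞(ℝ))}`. -/
def mixedNorm (μ b α : ℝ) (F : ℝ → ℝ → ℂ) : ℝ≥0∞ :=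
  (∫⁻ t in Ioi (0 : ℝ),
    (ENNReal.ofReal (t ^ μ) * eLpNorm (increment α (F t)) ⊤ volume) ^ (1 / b)) ^ b

/-- For fixed `μ, b`, the quantity
`sup_{α ≠ 0} ‖ t^μ δ_α Λ^{b-ε} (K(t,·) ∗ h) ‖_{L^{1/b}_t L^∞} / |α|^{μ+ε}`.
The function `F(t,·)` representing `Λ^{b-ε} (K(t,·) ∗ h)` is only determined modulo polynomials. If
`μ + ε < 1`, then among measurable `F` at most one choice (up to additive constants depending on `t`
and a null set of times) makes the supremum over `α` finite; the infimum selects it, and `δ_α F`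
does not see the constants. -/
def gTerm (ε μ b : ℝ) (h : 𝓢'(ℝ, ℂ)) : ℝ≥0∞ :=
  ⨅ (F : ℝ → ℝ → ℂ) (_ : ∀ t : ℝ, 0 < t → IsFracPoisson (b - ε) t h (F t)),
    ⨆ (α : ℝ) (_ : α ≠ 0), mixedNorm μ b α F / ENNReal.ofReal (|α| ^ (μ + ε))

/-- The norm of `𝒢̃` for a tempered distribution `h`, the supremum over `0 ≤ μ ≤ 2/3` and
`2ε ≤ b ≤ θ - μ - ε`. It does not change when a polynomial is added to `h`. -/
def tildeGNormRep (θ ε : ℝ) (h : 𝓢'(ℝ, ℂ)) : ℝ≥0∞ :=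
  ⨆ (μ : ℝ) (b : ℝ) (_ : 0 ≤ μ ∧ μ ≤ 2 / 3 ∧ 2 * ε ≤ b ∧ b ≤ θ - μ - ε), gTerm ε μ b h

/-- The norm of `𝒢̃` of a class modulo polynomials, with value `∞` outside the space. -/
def tildeGNorm (θ ε : ℝ) (x : TemperedModPoly) : ℝ≥0∞ :=
  ⨅ (h : 𝓢'(ℝ, ℂ)) (_ : polynomialDistributions.mkQ h = x), tildeGNormRep θ ε h

/-- The space `𝒢̃`. -/
def tildeG (θ ε : ℝ) : Set TemperedModPoly := {x | tildeGNorm θ ε x < ⊤}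

end

/-!
Both norms are infima over the representatives `h` of a class modulo polynomials, so it suffices to
compare `besovNormRep` and `tildeGNormRep` for a fixed tempered distribution `h`. The common tool is
a kernel estimate (`exists_scaled_kernel`): the multiplier with symbol `χ(ξ/R) |ξ|^σ e^{-t|ξ|/4}`,
where `χ` is smooth and supported in an annulus, is convolution with a kernel of `L¹` norm at most
`C R^σ (1 + |tR|)⁻³`, uniformly in `|σ| ≤ 1` and `tR ≥ -2`. This follows from bounds on the symbol and
its second derivative.

*The `𝒢̃` norm controls the Besov norm* (`exists_besovNormRep_le`). Take `μ = 0` and `b = 2ε`, and let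
`R = 2^j`. For a small constant `c`, depending on the support of `ϕ` only, the symbol
`1 - e^{-2πicξ/R}` of the increment of step `c/R` does not vanish on the support of `ϕ(ξ/R)`. Hence
`Δ_j h` is obtained from the increment `δ_{c/R} F(t)` by a multiplier which the kernel estimate, with
`-σ` and `-t` for `σ` and `t`, bounds by `C R^{-ε}` for all `t ∈ [1/R, 2/R]`. As the multiplier has
frequencies in an annulus, a polynomial added to `F(t)` plays no role. Integration over this time
interval gives the claim.

*The Besov norm controls the `𝒢̃` norm* (`exists_tildeGNormRep_le`). Put `σ = b - ε ≥ ε` and let `F(t)`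
be the sum over `j` of the blocks with symbols `ϕ(2^{-j}ξ) |ξ|^σ e^{-t|ξ|/4}`. By the kernel estimate
the `j`-th block is at most `2^{jσ} (1 + t 2^j)⁻³` in size, and its increment is smaller by the factor
`|α| 2^j`. Since `σ > 0` the series converges uniformly, and summation over `j` gives
`‖δ_α F(t)‖_∞ ≤ C min(t^{-σ}, |α| t^{-σ-1})` (`exists_isFracPoisson_increment_le`). The norm in `t` of
`t^μ` times this minimum is of order `|α|^{μ+ε}`, because `0 < μ + ε < 1` (`mixedNorm_le`).
-/

open scoped FourierTransform

/-! ### Convolution of a bounded function with a Schwartz kernel -/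

/-- The convolution `k ∗ g (y) = ∫ k(y - x) g(x) dx`. -/
noncomputable def kernelConv (k g : ℝ → ℂ) (y : ℝ) : ℂ := ∫ x : ℝ, k (y - x) * g x

/-- The operator on test functions dual to the Fourier multiplier `n` is convolution with the
reflection of the kernel `𝓕⁻ n`. -/
theorem fourier_smulLeftCLM_fourierInv_apply (n φ : 𝓢(ℝ, ℂ)) (x : ℝ) :
    𝓕 (SchwartzMap.smulLeftCLM ℂ n (𝓕⁻ φ)) x = ∫ y : ℝ, (𝓕⁻ n) (y - x) * φ y := by
  have h1 : 𝓕 (SchwartzMap.smulLeftCLM ℂ n (𝓕⁻ φ)) x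
      = SchwartzMap.convolution (ContinuousLinearMap.mul ℂ ℂ) (𝓕⁻ n) (𝓕⁻ (𝓕⁻ φ)) (-x) := by
    have : SchwartzMap.convolution (ContinuousLinearMap.mul ℂ ℂ) (𝓕⁻ n) (𝓕⁻ (𝓕⁻ φ))
        = 𝓕⁻ (SchwartzMap.smulLeftCLM ℂ n (𝓕⁻ φ)) := by
      have h := SchwartzMap.fourier_convolution (ContinuousLinearMap.mul ℂ ℂ) (𝓕⁻ n) (𝓕⁻ (𝓕⁻ φ))
      rw [← FourierTransform.fourierInv_fourier_eq (F := 𝓢(ℝ, ℂ))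
        (SchwartzMap.convolution (ContinuousLinearMap.mul ℂ ℂ) (𝓕⁻ n) (𝓕⁻ (𝓕⁻ φ))), h,
        FourierTransform.fourier_fourierInv_eq, FourierTransform.fourier_fourierInv_eq]
      congr 1
      ext ξ
      simp [SchwartzMap.pairing_apply_apply, SchwartzMap.smulLeftCLM_apply_apply n.hasTemperateGrowth]
    rw [this, SchwartzMap.fourierInv_coe, Real.fourierInv_eq_fourier_neg, neg_neg,
      SchwartzMap.fourier_coe]
  have h2 : ∀ z : ℝ, (𝓕⁻ (𝓕⁻ φ)) z = φ (-z) := by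
    intro z
    rw [SchwartzMap.fourierInv_coe, Real.fourierInv_eq_fourier_neg, ← SchwartzMap.fourier_coe,
      FourierTransform.fourier_fourierInv_eq]
  rw [h1, SchwartzMap.convolution_apply]
  simp only [convolution, ContinuousLinearMap.mul_apply', h2]
  rw [← integral_sub_right_eq_self _ x]
  congr 1
  ext y
  congr 2
  ring

/-- The duality `⟨g, n(D)ᵗ φ⟩ = ⟨𝓕⁻ n ∗ g, φ⟩` for a bounded function `g`. -/
theorem integral_multiplier_mul (n φ : 𝓢(ℝ, ℂ)) {g : ℝ → ℂ} {M : ℝ}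
    (hg : AEStronglyMeasurable g volume) (hM : ∀ᵐ x, ‖g x‖ ≤ M) :
    Integrable (fun y => φ y * kernelConv (𝓕⁻ n : 𝓢(ℝ, ℂ)) g y) ∧
      ∫ x, 𝓕 (SchwartzMap.smulLeftCLM ℂ n (𝓕⁻ φ)) x * g x
        = ∫ y, φ y * kernelConv (𝓕⁻ n : 𝓢(ℝ, ℂ)) g y := by
  have hint : Integrable (fun p : ℝ × ℝ => g p.1 * (φ p.2 * (𝓕⁻ n) (p.2 - p.1)))
      (volume.prod volume) := by
    have h1 := Integrable.convolution_integrand (ContinuousLinearMap.mul ℂ ℂ)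
      (μ := volume) (ν := volume) φ.integrable ((𝓕⁻ n).integrable (μ := volume)).comp_neg
    refine (h1.bdd_mul (f := fun p : ℝ × ℝ => g p.1) (c := M) ?_ ?_).congr ?_
    · exact hg.comp_fst
    · exact Measure.quasiMeasurePreserving_fst.ae hM
    · refine Filter.Eventually.of_forall fun p => ?_
      simp
  constructor
  · refine hint.integral_prod_right.congr (Filter.Eventually.of_forall fun y => ?_)
    simp only [kernelConv]
    rw [← integral_const_mul]
    congr 1; ext x; ring
  · have := integral_integral_swap (f := fun x y => g x * (φ y * (𝓕⁻ n : 𝓢(ℝ, ℂ)) (y - x))) hint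
    calc _ = ∫ x, ∫ y, g x * (φ y * (𝓕⁻ n) (y - x)) := by
          congr 1; ext x
          rw [fourier_smulLeftCLM_fourierInv_apply, mul_comm, ← integral_const_mul]
          congr 1; ext y; ring
      _ = ∫ y, ∫ x, g x * (φ y * (𝓕⁻ n) (y - x)) := this
      _ = _ := by
          congr 1; ext y
          simp only [kernelConv]
          rw [← integral_const_mul]
          congr 1; ext x; ring

/-- A function which defines a tempered distribution is measurable: divide by a Gaussian. -/
theorem IsGivenBy.aestronglyMeasurable {u : 𝓢'(ℝ, ℂ)} {F : ℝ → ℂ} (h : IsGivenBy u F) :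
    AEStronglyMeasurable F volume := by
  let f (n : ℕ) : ContDiffBump (0 : ℝ) := ⟨n + 1, n + 2, by positivity, by linarith⟩
  have hU : (⋃ n : ℕ, Metric.closedBall (0 : ℝ) (n + 1)) = univ := by
    refine eq_univ_of_forall fun x => mem_iUnion.2 ?_
    obtain ⟨n, hn⟩ := exists_nat_ge ‖x‖
    exact ⟨n, by simpa using hn.trans (by linarith)⟩
  rw [← Measure.restrict_univ (μ := volume), ← hU, aestronglyMeasurable_iUnion_iff]
  intro n
  have hc : HasCompactSupport fun x => ((f n x : ℝ) : ℂ) :=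
    (f n).hasCompactSupport.comp_left Complex.ofReal_zero
  have hs : ContDiff ℝ ∞ fun x => ((f n x : ℝ) : ℂ) :=
    Complex.ofRealCLM.contDiff.comp (f n).contDiff
  refine ((h (hc.toSchwartzMap hs)).1.aestronglyMeasurable.restrict).congr ?_
  refine (ae_restrict_iff' Metric.isClosed_closedBall.measurableSet).2
    (Filter.Eventually.of_forall fun x hx => ?_)
  have : f n x = 1 := (f n).one_of_mem_closedBall hx
  simp [this]

/-- A Schwartz multiplier maps a bounded function to its convolution with the kernel `𝓕⁻ n`. -/
theorem IsGivenBy.fourierMultiplier {u : 𝓢'(ℝ, ℂ)} {g : ℝ → ℂ} {M : ℝ} (h : IsGivenBy u g)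
    (hM : ∀ᵐ x, ‖g x‖ ≤ M) (n : 𝓢(ℝ, ℂ)) :
    IsGivenBy (TemperedDistribution.fourierMultiplierCLM ℂ n u) (kernelConv (𝓕⁻ n : 𝓢(ℝ, ℂ)) g) := by
  intro φ
  obtain ⟨h1, h2⟩ := integral_multiplier_mul n φ h.aestronglyMeasurable hM
  refine ⟨h1, ?_⟩
  rw [← h2, TemperedDistribution.fourierMultiplierCLM_apply_apply, (h _).2]

/-- The translate of a Fourier transform is the Fourier transform of a modulation. -/
theorem fourier_modulation_apply (α : ℝ) (f : ℝ → ℂ) (x : ℝ) :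
    𝓕 (fun ξ : ℝ => Complex.exp (-(2 * Real.pi * α * ξ : ℝ) * Complex.I) * f ξ) x
      = 𝓕 f (x + α) := by
  rw [Real.fourier_real_eq_integral_exp_smul, Real.fourier_real_eq_integral_exp_smul]
  congr 1; ext v
  rw [smul_eq_mul, smul_eq_mul, ← mul_assoc, ← Complex.exp_add]
  congr 2
  push_cast
  ring

/-- Only `δ_α F` has to be bounded for multipliers that contain the symbol `1 - e^{-2πiαξ}` of
`δ_α` as a factor. -/
theorem IsGivenBy.fourierMultiplier_increment {u : 𝓢'(ℝ, ℂ)} {F : ℝ → ℂ} {M α : ℝ}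
    (h : IsGivenBy u F) (hM : ∀ᵐ x, ‖increment α F x‖ ≤ M) (n m : 𝓢(ℝ, ℂ))
    (hm : ∀ ξ : ℝ, m ξ = (1 - Complex.exp (-(2 * Real.pi * α * ξ : ℝ) * Complex.I)) * n ξ) :
    IsGivenBy (TemperedDistribution.fourierMultiplierCLM ℂ m u)
      (kernelConv (𝓕⁻ n : 𝓢(ℝ, ℂ)) (increment α F)) := by
  have hF := h.aestronglyMeasurable
  have hFα : AEStronglyMeasurable (fun x => F (x - α)) volume :=
    hF.comp_measurePreserving (measurePreserving_sub_right volume α)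
  intro φ
  obtain ⟨h1, h2⟩ := integral_multiplier_mul n φ (hF.sub hFα) hM
  refine ⟨h1, ?_⟩
  change _ = ∫ y, φ y * kernelConv (𝓕⁻ n : 𝓢(ℝ, ℂ)) (F - fun x => F (x - α)) y
  rw [← h2, TemperedDistribution.fourierMultiplierCLM_apply_apply, (h _).2]
  set ψ : 𝓢(ℝ, ℂ) := 𝓕 (SchwartzMap.smulLeftCLM ℂ n (𝓕⁻ φ)) with hψ
  have key : ∀ x, 𝓕 (SchwartzMap.smulLeftCLM ℂ m (𝓕⁻ φ)) x = ψ x - ψ (x + α) := by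
    intro x
    rw [hψ, SchwartzMap.fourier_coe, SchwartzMap.fourier_coe, ← fourier_modulation_apply,
      Real.fourier_real_eq_integral_exp_smul, Real.fourier_real_eq_integral_exp_smul,
      Real.fourier_real_eq_integral_exp_smul, ← integral_sub]
    · congr 1; ext v
      rw [SchwartzMap.smulLeftCLM_apply_apply m.hasTemperateGrowth,
        SchwartzMap.smulLeftCLM_apply_apply n.hasTemperateGrowth, hm]
      simp only [smul_eq_mul]
      ring
    · refine ((SchwartzMap.smulLeftCLM ℂ n (𝓕⁻ φ)).integrable (μ := volume)).bdd_mul (c := 1)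
        (Continuous.aestronglyMeasurable (by fun_prop)) (Filter.Eventually.of_forall fun v => ?_)
      rw [Complex.norm_exp_ofReal_mul_I]
    · refine (((SchwartzMap.smulLeftCLM ℂ n (𝓕⁻ φ)).integrable (μ := volume)).bdd_mul (c := 1)
        (f := fun v : ℝ => Complex.exp (-(2 * Real.pi * α * v : ℝ) * Complex.I))
        (Continuous.aestronglyMeasurable (by fun_prop))
        (Filter.Eventually.of_forall fun v => ?_)).bdd_mul (c := 1)
        (Continuous.aestronglyMeasurable (by fun_prop)) (Filter.Eventually.of_forall fun v => ?_)
      · rw [← Complex.ofReal_neg, Complex.norm_exp_ofReal_mul_I]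
      · rw [Complex.norm_exp_ofReal_mul_I]
  have i1 : Integrable (fun x => ψ x * F x) := (h ψ).1
  have i2 : Integrable (fun x => ψ (x + α) * F x) := by
    have := (h (SchwartzMap.compSubConstCLM ℂ (-α) ψ)).1
    simpa using this
  have i3 : Integrable (fun x => ψ x * F (x - α)) := by
    have := i2.comp_sub_right α
    simpa using this
  calc ∫ x, 𝓕 (SchwartzMap.smulLeftCLM ℂ m (𝓕⁻ φ)) x * F x
      = ∫ x, (ψ x * F x - ψ (x + α) * F x) := by
        congr 1; ext x; rw [key]; ring
    _ = (∫ x, ψ x * F x) - ∫ x, ψ (x + α) * F x := integral_sub i1 i2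
    _ = (∫ x, ψ x * F x) - ∫ x, ψ x * F (x - α) := by
        rw [← integral_sub_right_eq_self (fun x => ψ (x + α) * F x) α]
        simp
    _ = _ := by
        rw [← integral_sub i1 i3]
        congr 1; ext x
        simp only [Pi.sub_apply]
        ring

/-! ### Kernels with quadratic decay at scale `1 / R` -/

theorem norm_fourier_le_of_support {f : ℝ → ℂ} {L M : ℝ} (hL : 0 ≤ L) (hM : ∀ ξ, ‖f ξ‖ ≤ M)
    (hf : ∀ ξ, L < |ξ| → f ξ = 0) (x : ℝ) : ‖𝓕 f x‖ ≤ 2 * L * M := by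
  have h0 : 𝓕 f x = ∫ v in Icc (-L) L, Complex.exp (↑(-2 * Real.pi * v * x) * Complex.I) • f v := by
    rw [Real.fourier_real_eq_integral_exp_smul, setIntegral_eq_integral_of_forall_compl_eq_zero]
    intro v hv
    rw [hf v, smul_zero]
    by_contra hc
    exact hv (abs_le.1 (not_lt.1 hc))
  rw [h0]
  have := norm_setIntegral_le_of_norm_le_const (μ := volume) (s := Icc (-L) L) (C := M)
    (f := fun v : ℝ => Complex.exp (↑(-2 * Real.pi * v * x) * Complex.I) • f v)
    (by simp) (fun v _ => by
      rw [norm_smul, Complex.norm_exp_ofReal_mul_I, one_mul]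
      exact hM v)
  refine this.trans (le_of_eq ?_)
  rw [Measure.real, Real.volume_Icc, ENNReal.toReal_ofReal (by linarith)]
  ring

/-- Two derivatives on the Fourier side give quadratic decay of the kernel. -/
theorem norm_fourierInv_le {n : 𝓢(ℝ, ℂ)} {A R M : ℝ} (hA : 0 < A) (hR : 0 < R)
    (hM : ∀ ξ, ‖n ξ‖ ≤ M) (hM2 : ∀ ξ, ‖deriv (deriv n) ξ‖ ≤ M / R ^ 2)
    (hn : ∀ ξ, A * R < |ξ| → n ξ = 0) (x : ℝ) :
    ‖(𝓕⁻ n : 𝓢(ℝ, ℂ)) x‖ ≤ 4 * A * M * (R / (1 + R ^ 2 * x ^ 2)) := by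
  have hAR : 0 ≤ A * R := by positivity
  have hM0 : 0 ≤ M := (norm_nonneg _).trans (hM 0)
  have h1 : ‖(𝓕⁻ n : 𝓢(ℝ, ℂ)) x‖ ≤ 2 * (A * R) * M := by
    rw [SchwartzMap.fourierInv_coe, Real.fourierInv_eq_fourier_neg]
    exact norm_fourier_le_of_support hAR hM hn _
  have hopen : IsOpen {ξ : ℝ | A * R < |ξ|} := isOpen_lt continuous_const continuous_abs
  have hz : ∀ f : ℝ → ℂ, (∀ ξ, A * R < |ξ| → f ξ = 0) → ∀ ξ, A * R < |ξ| → deriv f ξ = 0 := by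
    intro f hf ξ hξ
    have : f =ᶠ[nhds ξ] fun _ => 0 := by
      filter_upwards [hopen.mem_nhds hξ] with η hη using hf η hη
    rw [this.deriv_eq, deriv_const]
  have h2 : ‖𝓕 (deriv (deriv n)) (-x)‖ ≤ 2 * (A * R) * (M / R ^ 2) :=
    norm_fourier_le_of_support hAR hM2 (hz _ (hz _ hn)) _
  have hd1 : deriv n = SchwartzMap.derivCLM ℂ ℂ n := by
    ext ξ; simp
  have hd2 : deriv (deriv n) = SchwartzMap.derivCLM ℂ ℂ (SchwartzMap.derivCLM ℂ ℂ n) := by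
    ext ξ; rw [hd1]; simp
  have h3 : 𝓕 (deriv (deriv n)) (-x)
      = (2 * Real.pi * Complex.I * (-x : ℝ)) ^ 2 * 𝓕⁻ (n : ℝ → ℂ) x := by
    rw [Real.fourier_deriv, Real.fourier_deriv, Real.fourierInv_eq_fourier_neg]
    · simp only [smul_eq_mul]; ring
    · exact n.integrable
    · exact n.differentiable
    · rw [hd1]; exact SchwartzMap.integrable _
    · rw [hd1]; exact SchwartzMap.integrable _
    · rw [hd1]; exact SchwartzMap.differentiable _
    · rw [hd2]; exact SchwartzMap.integrable _
  rw [h3, norm_mul, norm_pow, ← SchwartzMap.fourierInv_coe] at h2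
  have hnorm : ‖(2 * Real.pi * Complex.I * (-x : ℝ) : ℂ)‖ ^ 2 = 4 * Real.pi ^ 2 * x ^ 2 := by
    simp only [norm_mul, Complex.norm_I, Complex.norm_real, Complex.norm_ofNat, Real.norm_eq_abs,
      mul_pow, sq_abs, neg_sq]
    ring
  rw [hnorm] at h2
  have hpi : 1 ≤ 4 * Real.pi ^ 2 := by nlinarith [Real.pi_gt_three]
  have h4 : R ^ 2 * x ^ 2 * ‖(𝓕⁻ n : 𝓢(ℝ, ℂ)) x‖ ≤ 2 * (A * R) * M := by
    have h5 : x ^ 2 * ‖(𝓕⁻ n : 𝓢(ℝ, ℂ)) x‖ ≤ 2 * (A * R) * (M / R ^ 2) := by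
      refine le_trans ?_ h2
      have : 0 ≤ x ^ 2 * ‖(𝓕⁻ n : 𝓢(ℝ, ℂ)) x‖ := by positivity
      nlinarith
    calc R ^ 2 * x ^ 2 * ‖(𝓕⁻ n : 𝓢(ℝ, ℂ)) x‖
        = R ^ 2 * (x ^ 2 * ‖(𝓕⁻ n : 𝓢(ℝ, ℂ)) x‖) := by ring
      _ ≤ R ^ 2 * (2 * (A * R) * (M / R ^ 2)) := by gcongr
      _ = _ := by field_simp
  rw [mul_div_assoc', le_div_iff₀ (by positivity)]
  nlinarith

theorem integrable_scaled_cauchy {R : ℝ} (hR : 0 < R) :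
    Integrable (fun x : ℝ => R / (1 + R ^ 2 * x ^ 2)) := by
  have := (integrable_inv_one_add_sq.comp_mul_left' hR.ne').const_mul R
  refine this.congr (Filter.Eventually.of_forall fun x => ?_)
  simp only [mul_pow]
  rfl

theorem integral_scaled_cauchy {R : ℝ} (hR : 0 < R) :
    ∫ x : ℝ, R / (1 + R ^ 2 * x ^ 2) = Real.pi := by
  have h := Measure.integral_comp_mul_left (fun x : ℝ => (1 + x ^ 2)⁻¹) R
  rw [integral_univ_inv_one_add_sq] at h
  simp only [div_eq_mul_inv, integral_const_mul]
  simp only [mul_pow] at h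
  rw [h, abs_of_pos (inv_pos.2 hR), smul_eq_mul, mul_inv_cancel_left₀ hR.ne']

theorem norm_kernelConv_le {k g : ℝ → ℂ} {D R M : ℝ} (hR : 0 < R) (hD : 0 ≤ D)
    (hk : ∀ x, ‖k x‖ ≤ D * (R / (1 + R ^ 2 * x ^ 2))) (hM : ∀ᵐ x, ‖g x‖ ≤ M) (y : ℝ) :
    ‖kernelConv k g y‖ ≤ Real.pi * D * M := by
  have hi : Integrable (fun x : ℝ => D * (R / (1 + R ^ 2 * (y - x) ^ 2)) * M) :=
    (((integrable_scaled_cauchy hR).comp_sub_left y).const_mul D).mul_const M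
  refine (norm_integral_le_of_norm_le hi ?_).trans (le_of_eq ?_)
  · filter_upwards [hM] with x hx
    rw [norm_mul]
    exact mul_le_mul (hk _) hx (norm_nonneg _) (by positivity)
  · rw [integral_mul_const, integral_const_mul,
      integral_sub_left_eq_self (fun x : ℝ => R / (1 + R ^ 2 * x ^ 2)) volume y,
      integral_scaled_cauchy hR]
    ring

/-- An increment of the convolution costs a factor `|α| R`. For `|α| R ≤ 1` this is the mean value
theorem, the decay profile being stable under shifts by at most `1 / R`; for `|α| R ≥ 1` it is the
triangle inequality. -/
theorem norm_kernelConv_sub_le {k g : ℝ → ℂ} {D R M : ℝ} (hR : 0 < R) (hD : 0 ≤ D) (hM0 : 0 ≤ M)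
    (hd : Differentiable ℝ k) (hk : ∀ x, ‖k x‖ ≤ D * (R / (1 + R ^ 2 * x ^ 2)))
    (hk' : ∀ x, ‖deriv k x‖ ≤ D * R * (R / (1 + R ^ 2 * x ^ 2)))
    (hg : AEStronglyMeasurable g volume) (hM : ∀ᵐ x, ‖g x‖ ≤ M) (α y : ℝ) :
    ‖kernelConv k g y - kernelConv k g (y - α)‖ ≤ 3 * (Real.pi * D * M) * (|α| * R) := by
  rcases le_total (|α| * R) 1 with hα | hα
  · have hint : ∀ z, Integrable (fun x => k (z - x) * g x) := by
      intro z
      refine Integrable.mul_bdd (c := M) ?_ hg hM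
      refine Integrable.mono' (((integrable_scaled_cauchy hR).comp_sub_left z).const_mul D) ?_
        (Filter.Eventually.of_forall fun x => hk _)
      exact (hd.continuous.comp (by fun_prop : Continuous fun x => z - x)).aestronglyMeasurable
    have heq : kernelConv k g y - kernelConv k g (y - α)
        = kernelConv (fun z => k z - k (z - α)) g y := by
      simp only [kernelConv]
      rw [← integral_sub (hint _) (hint _)]
      congr 1; ext x
      rw [show y - α - x = y - x - α by ring]
      ring
    rw [heq]
    have hbound : ∀ z, ‖k z - k (z - α)‖ ≤ (3 * D * (|α| * R)) * (R / (1 + R ^ 2 * z ^ 2)) := by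
      intro z
      have := (convex_Icc (z - |α|) (z + |α|)).norm_image_sub_le_of_norm_deriv_le (𝕜 := ℝ)
        (f := k) (x := z - α) (y := z) (C := 3 * D * R * (R / (1 + R ^ 2 * z ^ 2)))
        (fun w _ => hd w) ?_ ?_ ?_
      · refine this.trans (le_of_eq ?_)
        rw [sub_sub_cancel, Real.norm_eq_abs]; ring
      · intro w hw
        refine (hk' w).trans ?_
        rw [show 3 * D * R * (R / (1 + R ^ 2 * z ^ 2))
          = D * R * (R / ((1 + R ^ 2 * z ^ 2) / 3)) by field_simp]
        gcongr
        have hwz : |w - z| ≤ |α| := abs_le.2 ⟨by linarith [hw.1], by linarith [hw.2]⟩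
        have h1 : (|w - z| * R) ≤ 1 := (mul_le_mul_of_nonneg_right hwz hR.le).trans hα
        have h2 : (R * w - R * z) ^ 2 ≤ 1 := by
          have h3 : (R * w - R * z) ^ 2 = (|w - z| * R) ^ 2 := by
            rw [mul_pow, sq_abs]; ring
          rw [h3]
          have : 0 ≤ |w - z| * R := by positivity
          nlinarith
        nlinarith [sq_nonneg (R * w + (R * w - R * z))]
      · constructor
        · linarith [le_abs_self α]
        · linarith [neg_abs_le α]
      · constructor <;> linarith [abs_nonneg α]
    refine (norm_kernelConv_le hR (by positivity) hbound hM y).trans (le_of_eq (by ring))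
  · have h1 := norm_kernelConv_le hR hD hk hM y
    have h2 := norm_kernelConv_le hR hD hk hM (y - α)
    have h3 : 0 ≤ Real.pi * D * M := by positivity
    calc _ ≤ _ := norm_sub_le _ _
      _ ≤ 3 * (Real.pi * D * M) * 1 := by linarith
      _ ≤ _ := by gcongr

/-! ### Symbols `χ(ξ) |ξ|^σ e^{-s|ξ|/4}` localized to an annulus -/

/-- The localized symbol `χ(ξ) |ξ|^σ e^{-s|ξ|/4}`, with the power written as an exponential; the
value at `ξ = 0` is irrelevant when `χ` vanishes near `0`. -/
noncomputable def profile (χ : ℝ → ℂ) (σ s ξ : ℝ) : ℂ :=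
  χ ξ * (Real.exp (σ * Real.log ξ - s * |ξ| / 4) : ℂ)

theorem exists_annulus {χ : ℝ → ℂ} (hc : HasCompactSupport χ) (h0 : (0 : ℝ) ∉ tsupport χ) :
    ∃ A : ℝ, 1 ≤ A ∧ ∀ ξ ∈ tsupport χ, A⁻¹ ≤ |ξ| ∧ |ξ| ≤ A := by
  obtain ⟨B, hB⟩ := hc.isCompact.isBounded.exists_norm_le
  obtain ⟨r, hr, hr'⟩ := Metric.isOpen_iff.1 (isClosed_tsupport χ).isOpen_compl 0 h0
  refine ⟨max 1 (max B r⁻¹), le_max_left _ _, fun ξ hξ => ⟨?_, ?_⟩⟩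
  · have h1 : r ≤ |ξ| := by
      by_contra hlt
      exact hr' (by simpa using hlt : ξ ∈ Metric.ball (0 : ℝ) r) hξ
    refine le_trans ?_ h1
    rw [inv_le_comm₀ (by positivity) hr]
    exact (le_max_right _ _).trans (le_max_right _ _)
  · exact (hB ξ hξ).trans ((le_max_left _ _).trans (le_max_right _ _))

theorem contDiff_profile {χ : ℝ → ℂ} (hχ : ContDiff ℝ ∞ χ) (h0 : (0 : ℝ) ∉ tsupport χ)
    (σ s : ℝ) : ContDiff ℝ ∞ (profile χ σ s) := by
  rw [contDiff_iff_contDiffAt]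
  intro ξ
  by_cases hξ : ξ ∈ tsupport χ
  · have hne : ξ ≠ 0 := fun h => h0 (h ▸ hξ)
    have h1 : ContDiffAt ℝ ∞ (fun ξ : ℝ => Real.exp (σ * Real.log ξ - s * |ξ| / 4)) ξ :=
      ((contDiffAt_const.mul (Real.contDiffAt_log.2 hne)).sub
        ((contDiffAt_const.mul (contDiffAt_abs hne)).div_const 4)).exp
    exact hχ.contDiffAt.mul (Complex.ofRealCLM.contDiff.contDiffAt.comp ξ h1)
  · have : profile χ σ s =ᶠ[nhds ξ] fun _ => 0 := by
      filter_upwards [notMem_tsupport_iff_eventuallyEq.1 hξ] with η hη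
      simp [profile, hη]
    exact contDiffAt_const.congr_of_eventuallyEq this

theorem hasCompactSupport_profile {χ : ℝ → ℂ} (hc : HasCompactSupport χ) (σ s : ℝ) :
    HasCompactSupport (profile χ σ s) := hc.mul_right

theorem deriv_deriv_profile {χ : ℝ → ℂ} (hχ : ContDiff ℝ ∞ χ) (σ s : ℝ) {ξ : ℝ} (hξ : ξ ≠ 0) :
    ∃ c : ℝ, |c| = 1 ∧ deriv (deriv (profile χ σ s)) ξ
      = (deriv (deriv χ) ξ + 2 * deriv χ ξ * (σ / ξ - s * c / 4 : ℝ)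
        + χ ξ * (((σ / ξ - s * c / 4) ^ 2 - σ / ξ ^ 2 : ℝ) : ℂ))
        * (Real.exp (σ * Real.log ξ - s * |ξ| / 4) : ℂ) := by
  obtain ⟨c, hc1, hc⟩ : ∃ c : ℝ, |c| = 1 ∧ ∀ᶠ η in nhds ξ, |η| = c * η := by
    rcases lt_or_gt_of_ne hξ with h | h
    · refine ⟨-1, by simp, ?_⟩
      filter_upwards [eventually_lt_nhds h] with η hη
      rw [abs_of_neg hη]; ring
    · refine ⟨1, by simp, ?_⟩
      filter_upwards [eventually_gt_nhds h] with η hη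
      rw [abs_of_pos hη]; ring
  refine ⟨c, hc1, ?_⟩
  have hd1 : Differentiable ℝ χ := hχ.differentiable (by simp)
  have hd2 : Differentiable ℝ (deriv χ) :=
    (hχ.deriv' (n := ∞)).differentiable (by simp)
  let E : ℝ → ℂ := fun η => (Real.exp (σ * Real.log η - s * (c * η) / 4) : ℂ)
  have hE : ∀ η : ℝ, η ≠ 0 → HasDerivAt E ((σ / η - s * c / 4 : ℝ) * E η) η := by
    intro η hη
    have h1 : HasDerivAt (fun η : ℝ => σ * Real.log η - s * (c * η) / 4) (σ / η - s * c / 4) η := by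
      refine HasDerivAt.congr_deriv (((Real.hasDerivAt_log hη).const_mul σ).sub
        (((((hasDerivAt_id' η).const_mul c).const_mul s)).div_const 4)) ?_
      ring
    refine h1.exp.ofReal_comp.congr_deriv ?_
    simp only [E]
    push_cast; ring
  have hA : ∀ η : ℝ, η ≠ 0 →
      HasDerivAt (fun η : ℝ => ((σ / η - s * c / 4 : ℝ) : ℂ)) ((-(σ / η ^ 2) : ℝ) : ℂ) η := by
    intro η hη
    refine HasDerivAt.ofReal_comp ?_
    refine HasDerivAt.congr_deriv (((hasDerivAt_inv hη).const_mul σ).sub_const (s * c / 4)) ?_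
    ring
  have hP : ∀ η : ℝ, η ≠ 0 → HasDerivAt (fun η => χ η * E η)
      (deriv χ η * E η + χ η * ((σ / η - s * c / 4 : ℝ) * E η)) η :=
    fun η hη => (hd1 η).hasDerivAt.mul (hE η hη)
  have e1 : profile χ σ s =ᶠ[nhds ξ] fun η => χ η * E η := by
    filter_upwards [hc] with η hη
    simp only [profile, E, hη]
  have e2 : deriv (fun η => χ η * E η) =ᶠ[nhds ξ]
      fun η => deriv χ η * E η + χ η * ((σ / η - s * c / 4 : ℝ) * E η) := by
    filter_upwards [isOpen_ne.mem_nhds hξ] with η hη using (hP η hη).deriv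
  rw [e1.deriv.deriv_eq, e2.deriv_eq]
  have := ((hd2 ξ).hasDerivAt.mul (hE ξ hξ)).add
    ((hd1 ξ).hasDerivAt.mul ((hA ξ hξ).mul (hE ξ hξ)))
  refine this.deriv.trans ?_
  have hE' : (Real.exp (σ * Real.log ξ - s * |ξ| / 4) : ℂ) = E ξ := by
    simp only [E, hc.self_of_nhds]
  rw [hE', Pi.mul_apply]
  push_cast
  ring

/-- On the annulus `A⁻¹ ≤ |ξ| ≤ A` the factor `|ξ|^σ e^{-s|ξ|/4}` decays like `s⁻⁵`; the two
derivatives that kernel estimates need cost two of the five powers. -/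
theorem exp_profile_le {A σ s ξ : ℝ} (hA : 1 ≤ A) (hσ : |σ| ≤ 1) (hs : -2 ≤ s) (hξ : A⁻¹ ≤ |ξ|)
    (hξ' : |ξ| ≤ A) : Real.exp (σ * Real.log ξ - s * |ξ| / 4)
      ≤ A * Real.exp A * Real.exp 1 * (120 * (4 * A) ^ 5) / (1 + |s|) ^ 5 := by
  have hA0 : 0 < A := by linarith
  have hx : 0 < |ξ| := (inv_pos.2 hA0).trans_le hξ
  have h1 : σ * Real.log ξ ≤ Real.log A := by
    refine (le_abs_self _).trans ?_
    rw [abs_mul]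
    have : |Real.log ξ| ≤ Real.log A := by
      rw [← Real.log_abs ξ, abs_le, ← Real.log_inv]
      exact ⟨Real.log_le_log (inv_pos.2 hA0) hξ, Real.log_le_log hx hξ'⟩
    calc |σ| * |Real.log ξ| ≤ 1 * Real.log A := by gcongr
      _ = _ := one_mul _
  have h2 : -(s * |ξ| / 4) ≤ A + 1 - (1 + |s|) / (4 * A) := by
    have h3 : (1 + |s|) / (4 * A) = A⁻¹ * (1 + |s|) / 4 := by field_simp
    have hAi : A⁻¹ ≤ 1 := inv_le_one_of_one_le₀ hA
    have hAi0 : 0 < A⁻¹ := inv_pos.2 hA0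
    rw [h3]
    rcases le_total 0 s with h | h
    · rw [abs_of_nonneg h]
      nlinarith
    · rw [abs_of_nonpos h]
      nlinarith
  set y := (1 + |s|) / (4 * A) with hy
  have hy0 : 0 < y := by positivity
  have h4 : y ^ 5 / 120 ≤ Real.exp y := by
    have := Real.pow_div_factorial_le_exp y hy0.le 5
    norm_num [Nat.factorial] at this
    exact this
  calc Real.exp (σ * Real.log ξ - s * |ξ| / 4)
      ≤ Real.exp (Real.log A + (A + 1 - y)) := Real.exp_le_exp.2 (by linarith)
    _ = A * Real.exp A * Real.exp 1 * (Real.exp y)⁻¹ := by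
        rw [Real.exp_add, Real.exp_log hA0, Real.exp_sub, Real.exp_add]
        field_simp
    _ ≤ A * Real.exp A * Real.exp 1 * (y ^ 5 / 120)⁻¹ := by gcongr
    _ = _ := by
        rw [hy]; field_simp

/-- Bounds on the localized symbol and its second derivative, uniform in `σ` and `s`. Negative `s`
are included since `e^{-s|ξ|/4}` is inverted to recover `h` from its Poisson extension. -/
theorem exists_profile_bound {χ : ℝ → ℂ} (hχ : ContDiff ℝ ∞ χ) (hc : HasCompactSupport χ)
    (h0 : (0 : ℝ) ∉ tsupport χ) :
    ∃ C : ℝ, 0 < C ∧ ∀ σ s : ℝ, |σ| ≤ 1 → -2 ≤ s → ∀ ξ,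
      ‖profile χ σ s ξ‖ ≤ C / (1 + |s|) ^ 3 ∧
      ‖deriv (deriv (profile χ σ s)) ξ‖ ≤ C / (1 + |s|) ^ 3 := by
  obtain ⟨A, hA, hsupp⟩ := exists_annulus hc h0
  have hA0 : 0 < A := by linarith
  have hχ1 : ContDiff ℝ ∞ (deriv χ) := hχ.deriv'
  have hχ2 : ContDiff ℝ ∞ (deriv (deriv χ)) := hχ1.deriv'
  obtain ⟨B0, hB0⟩ := hχ.continuous.bounded_above_of_compact_support hc
  obtain ⟨B1, hB1⟩ := hχ1.continuous.bounded_above_of_compact_support hc.deriv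
  obtain ⟨B2, hB2⟩ := hχ2.continuous.bounded_above_of_compact_support hc.deriv.deriv
  obtain ⟨B, hB, hb0, hb1, hb2⟩ : ∃ B : ℝ, 0 < B ∧ B0 ≤ B ∧ B1 ≤ B ∧ B2 ≤ B := by
    refine ⟨max 1 (max B0 (max B1 B2)), by positivity, ?_, ?_, ?_⟩ <;> simp
  set K := A * Real.exp A * Real.exp 1 * (120 * (4 * A) ^ 5) with hK
  have hK0 : 0 < K := by positivity
  refine ⟨5 * A ^ 2 * B * K, by positivity, fun σ s hσ hs ξ => ?_⟩
  by_cases hξ : ξ ∈ tsupport χ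
  · obtain ⟨hξ1, hξ2⟩ := hsupp ξ hξ
    have hne : ξ ≠ 0 := fun h => h0 (h ▸ hξ)
    have hE := exp_profile_le hA hσ hs hξ1 hξ2
    set S := 1 + |s| with hS
    have hS1 : 1 ≤ S := by rw [hS]; linarith [abs_nonneg s]
    have hEn : ‖(Real.exp (σ * Real.log ξ - s * |ξ| / 4) : ℂ)‖ ≤ K / S ^ 5 := by
      rw [Complex.norm_real, Real.norm_eq_abs, Real.abs_exp]; exact hE
    have hfin : ∀ z : ℂ, ‖z‖ ≤ 5 * A ^ 2 * B * S ^ 2 →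
        ‖z * (Real.exp (σ * Real.log ξ - s * |ξ| / 4) : ℂ)‖ ≤ 5 * A ^ 2 * B * K / S ^ 3 := by
      intro z hz
      rw [norm_mul]
      calc _ ≤ (5 * A ^ 2 * B * S ^ 2) * (K / S ^ 5) := by gcongr
        _ = _ := by field_simp
    have hAS : 1 ≤ A ^ 2 * S ^ 2 := one_le_mul_of_one_le_of_one_le (one_le_pow₀ hA) (one_le_pow₀ hS1)
    refine ⟨hfin _ ?_, ?_⟩
    · refine ((hB0 ξ).trans hb0).trans ?_
      nlinarith
    · obtain ⟨c, hc1, hder⟩ := deriv_deriv_profile hχ σ s hne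
      rw [hder]
      refine hfin _ ?_
      have hinv : |ξ|⁻¹ ≤ A := inv_le_of_inv_le₀ hA0 hξ1
      have ha : |σ / ξ - s * c / 4| ≤ A * S := by
        refine (abs_sub _ _).trans ?_
        rw [abs_div, abs_div, abs_mul, hc1, div_eq_mul_inv, hS]
        have h1 : |σ| * |ξ|⁻¹ ≤ 1 * A := by gcongr
        rw [abs_of_pos (by norm_num : (0 : ℝ) < 4)]
        nlinarith [abs_nonneg s]
      have ha2 : |(σ / ξ - s * c / 4) ^ 2 - σ / ξ ^ 2| ≤ 2 * (A ^ 2 * S ^ 2) := by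
        refine (abs_sub _ _).trans ?_
        have h1 : |(σ / ξ - s * c / 4) ^ 2| ≤ A ^ 2 * S ^ 2 := by
          rw [abs_pow, ← mul_pow]; gcongr
        have h2 : |σ / ξ ^ 2| ≤ A ^ 2 * S ^ 2 := by
          rw [abs_div, abs_pow, div_eq_mul_inv, ← inv_pow]
          calc |σ| * |ξ|⁻¹ ^ 2 ≤ 1 * A ^ 2 := by gcongr
            _ ≤ A ^ 2 * S ^ 2 := by
              rw [one_mul]
              exact le_mul_of_one_le_right (by positivity) (one_le_pow₀ hS1)
        linarith
      have hASle : A * S ≤ A ^ 2 * S ^ 2 := by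
        rw [← mul_pow]
        exact le_self_pow₀ (one_le_mul_of_one_le_of_one_le hA hS1) two_ne_zero
      refine (norm_add₃_le).trans ?_
      rw [norm_mul, norm_mul, norm_mul, Complex.norm_real, Complex.norm_real, Real.norm_eq_abs,
        Real.norm_eq_abs, Complex.norm_ofNat]
      have t0 : ‖deriv (deriv χ) ξ‖ ≤ B * (A ^ 2 * S ^ 2) :=
        ((hB2 ξ).trans hb2).trans (le_mul_of_one_le_right hB.le hAS)
      have t1 : 2 * ‖deriv χ ξ‖ * |σ / ξ - s * c / 4| ≤ 2 * B * (A ^ 2 * S ^ 2) := by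
        have := (hB1 ξ).trans hb1
        have := ha.trans hASle
        gcongr
      have t2 : ‖χ ξ‖ * |(σ / ξ - s * c / 4) ^ 2 - σ / ξ ^ 2| ≤ B * (2 * (A ^ 2 * S ^ 2)) := by
        have := (hB0 ξ).trans hb0
        gcongr
      linarith
  · have hz : profile χ σ s =ᶠ[nhds ξ] fun _ => 0 := by
      filter_upwards [notMem_tsupport_iff_eventuallyEq.1 hξ] with η hη
      simp [profile, hη]
    have hz2 : deriv (profile χ σ s) =ᶠ[nhds ξ] fun _ => 0 := by
      refine hz.deriv.trans ?_
      simp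
    rw [hz2.deriv_eq, hz.self_of_nhds]
    simp only [norm_zero, deriv_const]
    constructor <;> positivity

theorem profile_scaled {χ : ℝ → ℂ} (h0 : (0 : ℝ) ∉ tsupport χ) {R : ℝ} (hR : 0 < R)
    (σ t ξ : ℝ) :
    χ (R⁻¹ * ξ) * (poissonSymbol σ t ξ : ℂ) = (R ^ σ : ℝ) * profile χ σ (t * R) (R⁻¹ * ξ) := by
  by_cases hξ : ξ = 0
  · have : χ 0 = 0 := image_eq_zero_of_notMem_tsupport h0
    simp [profile, hξ, this]
  · have hx : 0 < |ξ| := abs_pos.2 hξ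
    have : poissonSymbol σ t ξ
        = R ^ σ * Real.exp (σ * Real.log (R⁻¹ * ξ) - t * R * |R⁻¹ * ξ| / 4) := by
      rw [poissonSymbol, Real.rpow_def_of_pos hR, Real.rpow_def_of_pos hx, ← Real.exp_add,
        ← Real.exp_add, Real.log_mul (inv_ne_zero hR.ne') hξ, Real.log_inv, abs_mul,
        abs_of_pos (inv_pos.2 hR), Real.log_abs]
      congr 1
      field_simp
      ring
    rw [this, profile]
    push_cast
    ring

/-- The kernel of `χ(ξ/R) |ξ|^σ e^{-t|ξ|/4}` decays at scale `1 / R`, with amplitude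
`R^σ (1 + |tR|)⁻³`. -/
theorem exists_scaled_symbol {χ : ℝ → ℂ} (hχ : ContDiff ℝ ∞ χ) (hc : HasCompactSupport χ)
    (h0 : (0 : ℝ) ∉ tsupport χ) :
    ∃ D : ℝ, 0 < D ∧ ∀ σ t R : ℝ, |σ| ≤ 1 → 0 < R → -2 ≤ t * R → ∃ n : 𝓢(ℝ, ℂ),
      (∀ ξ, n ξ = χ (R⁻¹ * ξ) * (poissonSymbol σ t ξ : ℂ)) ∧
      ∀ x, ‖(𝓕⁻ n : 𝓢(ℝ, ℂ)) x‖
        ≤ D * (R ^ σ / (1 + |t * R|) ^ 3) * (R / (1 + R ^ 2 * x ^ 2)) := by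
  obtain ⟨A, hA, hsupp⟩ := exists_annulus hc h0
  obtain ⟨C, hC, hbd⟩ := exists_profile_bound hχ hc h0
  have hA0 : 0 < A := by linarith
  refine ⟨4 * A * C, by positivity, fun σ t R hσ hR ht => ?_⟩
  let f : ℝ → ℂ := fun ξ => (R ^ σ : ℝ) * profile χ σ (t * R) (R⁻¹ * ξ)
  have hfs : ContDiff ℝ ∞ f :=
    contDiff_const.mul ((contDiff_profile hχ h0 _ _).comp (contDiff_const.mul contDiff_id))
  have hfc : HasCompactSupport f :=
    ((hasCompactSupport_profile hc σ (t * R)).comp_homeomorph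
      (Homeomorph.mulLeft₀ R⁻¹ (inv_ne_zero hR.ne'))).mul_left
  refine ⟨hfc.toSchwartzMap hfs, fun ξ => (profile_scaled h0 hR σ t ξ).symm, fun x => ?_⟩
  have hRσ : 0 < R ^ σ := Real.rpow_pos_of_pos hR σ
  have hcoe : ⇑(hfc.toSchwartzMap hfs) = f := rfl
  have hd : deriv (deriv f) = fun ξ => ((R ^ σ : ℝ) : ℂ) *
      (R⁻¹ • (R⁻¹ • deriv (deriv (profile χ σ (t * R))) (R⁻¹ * ξ))) := by
    have h1 : deriv f = fun ξ =>
        ((R ^ σ : ℝ) : ℂ) * (R⁻¹ • deriv (profile χ σ (t * R)) (R⁻¹ * ξ)) := by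
      ext ξ
      simp only [f]
      rw [deriv_const_mul_field, deriv_comp_mul_left]
    rw [h1]
    ext ξ
    rw [deriv_const_mul_field, deriv_fun_const_smul_field, deriv_comp_mul_left]
  have := norm_fourierInv_le (n := hfc.toSchwartzMap hfs) (A := A) (R := R)
    (M := R ^ σ * (C / (1 + |t * R|) ^ 3)) hA0 hR ?_ ?_ ?_ x
  · refine this.trans (le_of_eq ?_)
    ring
  · intro ξ
    rw [hcoe, norm_mul, Complex.norm_real, Real.norm_of_nonneg hRσ.le]
    gcongr
    exact (hbd σ (t * R) hσ ht _).1
  · intro ξ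
    rw [hcoe, hd, norm_mul, Complex.norm_real, Real.norm_of_nonneg hRσ.le, norm_smul, norm_smul,
      Real.norm_of_nonneg (inv_pos.2 hR).le]
    have := (hbd σ (t * R) hσ ht (R⁻¹ * ξ)).2
    calc _ ≤ R ^ σ * (R⁻¹ * (R⁻¹ * (C / (1 + |t * R|) ^ 3))) := by gcongr
      _ = _ := by field_simp
  · intro ξ hξ
    have : χ (R⁻¹ * ξ) = 0 := by
      by_contra hne
      have h2 := (hsupp _ (subset_tsupport _ hne)).2
      rw [abs_mul, abs_of_pos (inv_pos.2 hR), inv_mul_le_iff₀ hR] at h2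
      linarith
    simp [f, profile, this]

/-- The kernel of `χ(ξ/R) |ξ|^σ e^{-t|ξ|/4}` and its derivative decay at scale `1 / R`. -/
theorem exists_scaled_kernel {χ : ℝ → ℂ} (hχ : ContDiff ℝ ∞ χ) (hc : HasCompactSupport χ)
    (h0 : (0 : ℝ) ∉ tsupport χ) :
    ∃ D : ℝ, 0 < D ∧ ∀ σ t R : ℝ, |σ| ≤ 1 → 0 < R → -2 ≤ t * R → ∃ n : 𝓢(ℝ, ℂ),
      (∀ ξ, n ξ = χ (R⁻¹ * ξ) * (poissonSymbol σ t ξ : ℂ)) ∧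
      (∀ x, ‖(𝓕⁻ n : 𝓢(ℝ, ℂ)) x‖
        ≤ D * (R ^ σ / (1 + |t * R|) ^ 3) * (R / (1 + R ^ 2 * x ^ 2))) ∧
      ∀ x, ‖deriv (𝓕⁻ n : 𝓢(ℝ, ℂ)) x‖
        ≤ D * (R ^ σ / (1 + |t * R|) ^ 3) * R * (R / (1 + R ^ 2 * x ^ 2)) := by
  obtain ⟨D₁, hD₁, h₁⟩ := exists_scaled_symbol hχ hc h0
  -- Differentiating the kernel multiplies the symbol by `2πiξ`.
  let χ' : ℝ → ℂ := fun ξ => (2 * Real.pi * Complex.I * ξ) * χ ξ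
  have hχ' : ContDiff ℝ ∞ χ' := (contDiff_const.mul Complex.ofRealCLM.contDiff).mul hχ
  have hc' : HasCompactSupport χ' := hc.mul_left
  have h0' : (0 : ℝ) ∉ tsupport χ' := fun h => h0 (tsupport_mul_subset_right h)
  obtain ⟨D₂, hD₂, h₂⟩ := exists_scaled_symbol hχ' hc' h0'
  refine ⟨max D₁ D₂, by positivity, fun σ t R hσ hR ht => ?_⟩
  obtain ⟨n, hn, hk⟩ := h₁ σ t R hσ hR ht
  obtain ⟨n', hn', hk'⟩ := h₂ σ t R hσ hR ht
  have hRσ : 0 < R ^ σ := Real.rpow_pos_of_pos hR σ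
  refine ⟨n, hn, fun x => (hk x).trans ?_, fun x => ?_⟩
  · gcongr; exact le_max_left _ _
  · have hder : deriv (𝓕⁻ n : 𝓢(ℝ, ℂ)) x = R * (𝓕⁻ n' : 𝓢(ℝ, ℂ)) x := by
      have hi : Integrable (fun x : ℝ => x • n x) := by
        have := (SchwartzMap.smulLeftCLM ℂ (fun x : ℝ => (x : ℂ)) n).integrable (μ := volume)
        rw [SchwartzMap.smulLeftCLM_apply (by fun_prop)] at this
        simpa using this
      have h3 := (Real.hasDerivAt_fourier (n.integrable (μ := volume)) hi (-x)).scomp x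
        (hasDerivAt_neg x)
      have h4 : ⇑(𝓕⁻ n : 𝓢(ℝ, ℂ)) = 𝓕 (n : ℝ → ℂ) ∘ (fun y : ℝ => -y) := by
        ext y
        rw [SchwartzMap.fourierInv_coe, Real.fourierInv_eq_fourier_neg]
        rfl
      rw [h4, h3.deriv, SchwartzMap.fourierInv_coe, Real.fourierInv_eq_fourier_neg,
        Real.fourier_real_eq_integral_exp_smul, Real.fourier_real_eq_integral_exp_smul,
        ← integral_const_mul, neg_smul, one_smul, ← integral_neg]
      congr 1; ext v
      simp only [hn, hn', χ', smul_eq_mul]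
      have : (R : ℂ) ≠ 0 := by exact_mod_cast hR.ne'
      push_cast
      field_simp
    rw [hder, norm_mul, Complex.norm_real, Real.norm_of_nonneg hR.le]
    calc R * ‖(𝓕⁻ n' : 𝓢(ℝ, ℂ)) x‖
        ≤ R * (D₂ * (R ^ σ / (1 + |t * R|) ^ 3) * (R / (1 + R ^ 2 * x ^ 2))) := by
          gcongr; exact hk' x
      _ = D₂ * (R ^ σ / (1 + |t * R|) ^ 3) * R * (R / (1 + R ^ 2 * x ^ 2)) := by ring
      _ ≤ _ := by gcongr; exact le_max_right _ _

/-! ### The dyadic blocks are controlled by increments of the Poisson extension -/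

theorem zero_notMem_tsupport_scaled {χ : ℝ → ℂ} (h0 : (0 : ℝ) ∉ tsupport χ) {R : ℝ} (hR : R ≠ 0)
    (f : ℝ → ℂ) : (0 : ℝ) ∉ tsupport (fun ξ => χ (R * ξ) * f ξ) := by
  intro h
  have h1 := tsupport_mul_subset_left h
  have h2 := tsupport_comp_eq_preimage χ (Homeomorph.mulLeft₀ R hR)
  have h3 : (0 : ℝ) ∈ tsupport (χ ∘ Homeomorph.mulLeft₀ R hR) := h1
  rw [h2] at h3
  simp at h3
  exact h0 h3

theorem hasCompactSupport_scaled {χ : ℝ → ℂ} (hc : HasCompactSupport χ) {R : ℝ} (hR : R ≠ 0)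
    (f : ℝ → ℂ) : HasCompactSupport (fun ξ => χ (R * ξ) * f ξ) :=
  (hc.comp_homeomorph (Homeomorph.mulLeft₀ R hR)).mul_right

theorem tsupport_ofReal_comp (ϕ : ℝ → ℝ) :
    tsupport (fun ξ => (ϕ ξ : ℂ)) = tsupport ϕ := by
  have : Function.support (fun ξ => (ϕ ξ : ℂ)) = Function.support ϕ := by
    ext ξ; simp
  rw [tsupport, this, tsupport]

theorem IsLittlewoodPaley.contDiff_ofReal {ϕ : ℝ → ℝ} (h : IsLittlewoodPaley ϕ) :
    ContDiff ℝ ∞ (fun ξ => (ϕ ξ : ℂ)) :=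
  Complex.ofRealCLM.contDiff.comp h.contDiff

theorem IsLittlewoodPaley.hasCompactSupport_ofReal {ϕ : ℝ → ℝ} (h : IsLittlewoodPaley ϕ) :
    HasCompactSupport (fun ξ => (ϕ ξ : ℂ)) :=
  h.hasCompactSupport.comp_left Complex.ofReal_zero

theorem IsLittlewoodPaley.zero_notMem_ofReal {ϕ : ℝ → ℝ} (h : IsLittlewoodPaley ϕ) :
    (0 : ℝ) ∉ tsupport (fun ξ => (ϕ ξ : ℂ)) := by
  rw [tsupport_ofReal_comp]
  exact h.zero_notMem

theorem poissonSymbol_neg_mul (σ t : ℝ) {ξ : ℝ} (hξ : ξ ≠ 0) :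
    poissonSymbol (-σ) (-t) ξ * poissonSymbol σ t ξ = 1 := by
  have hx : 0 < |ξ| := abs_pos.2 hξ
  rw [poissonSymbol, poissonSymbol, mul_mul_mul_comm, ← Real.rpow_add hx, ← Real.exp_add]
  simp [← add_div]

/-- On an annulus, division by the symbol `1 - e^{-2πicξ}` of the increment is harmless for small
`c`. -/
theorem exists_div_modulation {ϕ : ℝ → ℂ} (hs : ContDiff ℝ ∞ ϕ) (hc : HasCompactSupport ϕ)
    (h0 : (0 : ℝ) ∉ tsupport ϕ) :
    ∃ (c : ℝ) (χ : ℝ → ℂ), 0 < c ∧ ContDiff ℝ ∞ χ ∧ HasCompactSupport χ ∧ (0 : ℝ) ∉ tsupport χ ∧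
      ∀ ξ, (1 - Complex.exp (-(2 * Real.pi * c * ξ : ℝ) * Complex.I)) * χ ξ = ϕ ξ := by
  obtain ⟨A, hA, hsupp⟩ := exists_annulus hc h0
  have hA0 : 0 < A := by linarith
  let d : ℝ → ℂ := fun ξ => 1 - Complex.exp (-(2 * Real.pi * (2 * A)⁻¹ * ξ : ℝ) * Complex.I)
  have hd : ContDiff ℝ ∞ d := by
    have : ContDiff ℝ ∞ (fun ξ : ℝ => (-(2 * Real.pi * (2 * A)⁻¹ * ξ : ℝ) : ℂ) * Complex.I) :=
      (Complex.ofRealCLM.contDiff.comp (contDiff_const.mul contDiff_id)).neg.mul contDiff_const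
    exact contDiff_const.sub this.cexp
  have hd0 : ∀ ξ ∈ tsupport ϕ, d ξ ≠ 0 := by
    intro ξ hξ h
    obtain ⟨h1, h2⟩ := hsupp ξ hξ
    have hx : 0 < |ξ| := (inv_pos.2 hA0).trans_le h1
    have h3 : Complex.exp (-(2 * Real.pi * (2 * A)⁻¹ * ξ : ℝ) * Complex.I) = 1 :=
      (sub_eq_zero.1 h).symm
    obtain ⟨k, hk⟩ := Complex.exp_eq_one_iff.1 h3
    have h4 : -(ξ / (2 * A)) = k := by
      have h5 := congrArg Complex.im hk
      simp at h5
      field_simp at h5 ⊢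
      linarith
    have h6 : |(k : ℝ)| = |ξ| / (2 * A) := by
      rw [← h4, abs_neg, abs_div, abs_of_pos (by positivity : 0 < 2 * A)]
    have h7 : |(k : ℝ)| < 1 := by
      rw [h6, div_lt_one (by positivity)]; linarith
    have h8 : k = 0 := by
      rw [← Int.cast_abs] at h7
      exact Int.abs_lt_one_iff.1 (by exact_mod_cast h7)
    rw [h8, Int.cast_zero, abs_zero] at h6
    have h9 : 0 < |ξ| / (2 * A) := by positivity
    exact h9.ne h6
  refine ⟨(2 * A)⁻¹, fun ξ => ϕ ξ * (d ξ)⁻¹, by positivity, ?_, hc.mul_right,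
    fun h => h0 (tsupport_mul_subset_left h), fun ξ => ?_⟩
  · rw [contDiff_iff_contDiffAt]
    intro ξ
    by_cases hξ : ξ ∈ tsupport ϕ
    · exact hs.contDiffAt.mul (hd.contDiffAt.inv (hd0 ξ hξ))
    · have : (fun ξ => ϕ ξ * (d ξ)⁻¹) =ᶠ[nhds ξ] fun _ => 0 := by
        filter_upwards [notMem_tsupport_iff_eventuallyEq.1 hξ] with η hη
        simp [hη]
      exact contDiffAt_const.congr_of_eventuallyEq this
  · change d ξ * (ϕ ξ * (d ξ)⁻¹) = ϕ ξ
    by_cases hξ : ϕ ξ = 0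
    · simp [hξ]
    · field_simp [hd0 ξ (subset_tsupport _ hξ)]

theorem ae_norm_le_of_eLpNorm_top {g : ℝ → ℂ} (hg : eLpNorm g ⊤ volume ≠ ⊤) :
    ∀ᵐ x, ‖g x‖ ≤ (eLpNorm g ⊤ volume).toReal := by
  rw [eLpNorm_exponent_top] at *
  filter_upwards [ae_le_eLpNormEssSup (f := g) (μ := volume)] with x hx
  rw [← toReal_enorm]
  exact ENNReal.toReal_mono hg hx

theorem supNorm_le_of_bound {u : 𝓢'(ℝ, ℂ)} {g : ℝ → ℂ} {M : ℝ} (h : IsGivenBy u g)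
    (hM : ∀ x, ‖g x‖ ≤ M) : supNorm u ≤ ENNReal.ofReal M := by
  refine (iInf₂_le g h).trans ?_
  rw [eLpNorm_exponent_top]
  exact eLpNormEssSup_le_of_ae_bound (Filter.Eventually.of_forall hM)

/-- The block `Δ_j h` is recovered from an increment of step `c 2^{-j}` of `Λ^σ (K(t,·) ∗ h)` at
any time `t` comparable to `2^{-j}`. -/
theorem exists_supNorm_dyadicBlock_le {ϕ : ℝ → ℝ} (hϕ : IsLittlewoodPaley ϕ) :
    ∃ c C : ℝ, 0 < c ∧ 0 < C ∧ ∀ (σ t : ℝ) (j : ℤ) (h : 𝓢'(ℝ, ℂ)) (F : ℝ → ℂ), |σ| ≤ 1 →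
      0 < t → t * 2 ^ j ≤ 2 → IsFracPoisson σ t h F →
      supNorm (dyadicBlock ϕ j h) ≤ ENNReal.ofReal (C * ((2 : ℝ) ^ j) ^ (-σ)) *
        eLpNorm (increment (c * (2 ^ j)⁻¹) F) ⊤ volume := by
  obtain ⟨c, χ, hc, hχ, hχc, hχ0, hχϕ⟩ := exists_div_modulation hϕ.contDiff_ofReal
    hϕ.hasCompactSupport_ofReal hϕ.zero_notMem_ofReal
  obtain ⟨D, hD, hker⟩ := exists_scaled_symbol hχ hχc hχ0
  obtain ⟨_, -, hker'⟩ := exists_scaled_symbol hϕ.contDiff_ofReal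
    hϕ.hasCompactSupport_ofReal hϕ.zero_notMem_ofReal
  refine ⟨c, Real.pi * D, hc, by positivity, fun σ t j h F hσ ht htj hF => ?_⟩
  set R : ℝ := 2 ^ j with hR
  have hR0 : 0 < R := by positivity
  have hRσ : 0 < R ^ (-σ) := Real.rpow_pos_of_pos hR0 _
  obtain ⟨n, hn, hnk⟩ := hker (-σ) (-t) R (by rwa [abs_neg]) hR0 (by linarith)
  obtain ⟨m, hm, -⟩ := hker' (-σ) (-t) R (by rwa [abs_neg]) hR0 (by linarith)
  have hmn : ∀ ξ : ℝ, m ξ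
      = (1 - Complex.exp (-(2 * Real.pi * (c * R⁻¹) * ξ : ℝ) * Complex.I)) * n ξ := by
    intro ξ
    rw [hm, hn, ← hχϕ, mul_assoc]
    congr 5
    ring_nf
  obtain ⟨u, hu, hmul⟩ := hF
  have hmeq : (m : ℝ → ℂ) = fun ξ => (ϕ (R⁻¹ * ξ) : ℂ) * (poissonSymbol (-σ) (-t) ξ : ℂ) :=
    funext hm
  have hblock : TemperedDistribution.fourierMultiplierCLM ℂ m u = dyadicBlock ϕ j h := by
    rw [hmul m (m.smooth ⊤) ?_ ?_, dyadicBlock]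
    · congr 2
      ext ξ
      rw [hm, zpow_neg, mul_assoc, ← Complex.ofReal_mul]
      by_cases hξ : ξ = 0
      · have : ϕ 0 = 0 := image_eq_zero_of_notMem_tsupport hϕ.zero_notMem
        simp [hξ, this]
      · rw [poissonSymbol_neg_mul σ t hξ]; simp [hR]
    · rw [hmeq]
      exact hasCompactSupport_scaled hϕ.hasCompactSupport_ofReal (inv_ne_zero hR0.ne') _
    · rw [hmeq]
      exact zero_notMem_tsupport_scaled hϕ.zero_notMem_ofReal (inv_ne_zero hR0.ne') _
  set G := increment (c * R⁻¹) F with hG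
  by_cases htop : eLpNorm G ⊤ volume = ⊤
  · rw [htop, ENNReal.mul_top]
    · exact le_top
    · rw [ne_eq, ENNReal.ofReal_eq_zero, not_le]; positivity
  have hM := ae_norm_le_of_eLpNorm_top htop
  have hgiven := hu.fourierMultiplier_increment hM n m hmn
  rw [hblock] at hgiven
  have hnk' : ∀ x, ‖(𝓕⁻ n : 𝓢(ℝ, ℂ)) x‖ ≤ D * R ^ (-σ) * (R / (1 + R ^ 2 * x ^ 2)) := by
    intro x
    refine (hnk x).trans ?_
    gcongr
    refine div_le_self hRσ.le (one_le_pow₀ ?_)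
    linarith [abs_nonneg (-t * R)]
  refine (supNorm_le_of_bound hgiven
    (norm_kernelConv_le hR0 (by positivity) hnk' hM)).trans (le_of_eq ?_)
  rw [ENNReal.ofReal_mul (by positivity), ENNReal.ofReal_toReal htop, mul_assoc]

/-- The indices `μ = 0`, `b = 2ε` alone control the Besov norm: the lower bound for the increment
holds at every time in `[2^{-j}, 2·2^{-j}]` and for every admissible family `F`, whether or not it is
measurable in `t`. -/
theorem exists_besovNormRep_le {ϕ : ℝ → ℝ} (hϕ : IsLittlewoodPaley ϕ) {ε : ℝ} (hε : 0 < ε)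
    (hε1 : ε ≤ 1) : ∃ C : ℝ≥0, 0 < C ∧ ∀ h : 𝓢'(ℝ, ℂ),
      besovNormRep ϕ h ≤ C * gTerm ε 0 (2 * ε) h := by
  obtain ⟨c, C, hc, hC, hbd⟩ := exists_supNorm_dyadicBlock_le hϕ
  have hC' : 0 < C * c ^ ε := by positivity
  refine ⟨(C * c ^ ε).toNNReal, Real.toNNReal_pos.2 hC', fun h => iSup_le fun j => ?_⟩
  change _ ≤ ENNReal.ofReal (C * c ^ ε) * _
  rw [gTerm, ENNReal.mul_iInf_of_ne (by simpa using hC') ENNReal.ofReal_ne_top]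
  refine le_iInf fun F => ?_
  rw [ENNReal.mul_iInf_of_ne (by simpa using hC') ENNReal.ofReal_ne_top]
  refine le_iInf fun hF => ?_
  set S := ⨆ (α : ℝ) (_ : α ≠ 0), mixedNorm 0 (2 * ε) α F / ENNReal.ofReal (|α| ^ (0 + ε)) with hS
  set X := supNorm (dyadicBlock ϕ j h) with hX
  set R : ℝ := 2 ^ j with hR
  have hR0 : 0 < R := by positivity
  set α := c * R⁻¹ with hα
  have hα0 : 0 < α := by positivity
  have hmix : mixedNorm 0 (2 * ε) α F ≤ S * ENNReal.ofReal (α ^ ε) := by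
    have h1 : mixedNorm 0 (2 * ε) α F / ENNReal.ofReal (|α| ^ (0 + ε)) ≤ S :=
      le_iSup₂ (f := fun (α : ℝ) (_ : α ≠ 0) =>
        mixedNorm 0 (2 * ε) α F / ENNReal.ofReal (|α| ^ (0 + ε))) α hα0.ne'
    rw [abs_of_pos hα0, zero_add] at h1
    have h2 : 0 < α ^ ε := Real.rpow_pos_of_pos hα0 _
    exact (ENNReal.div_le_iff (by simpa using h2) ENNReal.ofReal_ne_top).1 h1
  have hc1 : 0 < C * R ^ (-ε) := by positivity
  have hpt : ∀ t ∈ Icc R⁻¹ (2 * R⁻¹), X / ENNReal.ofReal (C * R ^ (-ε))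
      ≤ ENNReal.ofReal (t ^ (0 : ℝ)) * eLpNorm (increment α (F t)) ⊤ volume := by
    intro t ht
    have ht0 : 0 < t := (inv_pos.2 hR0).trans_le ht.1
    rw [Real.rpow_zero, ENNReal.ofReal_one, one_mul,
      ENNReal.div_le_iff' (by simpa using hc1) ENNReal.ofReal_ne_top]
    refine hbd ε t j h (F t) (by rwa [abs_of_pos hε]) ht0 ?_ ?_
    · calc t * R ≤ 2 * R⁻¹ * R := by gcongr; exact ht.2
        _ = 2 := by field_simp
    · have := hF t ht0
      rwa [show 2 * ε - ε = ε by ring] at this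
  have hb : 0 < 2 * ε := by positivity
  have hlow : X / ENNReal.ofReal (C * R ^ (-ε)) * ENNReal.ofReal (R⁻¹ ^ (2 * ε))
      ≤ mixedNorm 0 (2 * ε) α F := by
    calc X / ENNReal.ofReal (C * R ^ (-ε)) * ENNReal.ofReal (R⁻¹ ^ (2 * ε))
        = (∫⁻ _ in Icc R⁻¹ (2 * R⁻¹), (X / ENNReal.ofReal (C * R ^ (-ε))) ^ (1 / (2 * ε)))
            ^ (2 * ε) := by
          rw [setLIntegral_const, Real.volume_Icc, ENNReal.mul_rpow_of_nonneg _ _ hb.le,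
            ← ENNReal.rpow_mul, one_div, inv_mul_cancel₀ hb.ne', ENNReal.rpow_one,
            ENNReal.ofReal_rpow_of_nonneg (by linarith [inv_pos.2 hR0]) hb.le]
          congr 3
          ring
      _ ≤ (∫⁻ t in Icc R⁻¹ (2 * R⁻¹), (ENNReal.ofReal (t ^ (0 : ℝ)) *
            eLpNorm (increment α (F t)) ⊤ volume) ^ (1 / (2 * ε))) ^ (2 * ε) := by
          refine ENNReal.rpow_le_rpow (setLIntegral_mono' measurableSet_Icc fun t ht => ?_) hb.le
          exact ENNReal.rpow_le_rpow (hpt t ht) (by positivity)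
      _ ≤ mixedNorm 0 (2 * ε) α F := by
          refine ENNReal.rpow_le_rpow (lintegral_mono_set fun t ht => ?_) hb.le
          exact (inv_pos.2 hR0).trans_le ht.1
  have hRb : 0 < R⁻¹ ^ (2 * ε) := by positivity
  have h3 := hlow.trans hmix
  rw [← ENNReal.le_div_iff_mul_le (Or.inl (by simpa using hRb)) (Or.inl ENNReal.ofReal_ne_top),
    ENNReal.div_le_iff' (by simpa using hc1) ENNReal.ofReal_ne_top] at h3
  refine h3.trans (le_of_eq ?_)
  rw [mul_div_assoc, ← ENNReal.ofReal_div_of_pos hRb, mul_left_comm,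
    ← ENNReal.ofReal_mul hc1.le, mul_comm S]
  congr 2
  rw [hα, Real.mul_rpow hc.le (inv_pos.2 hR0).le, Real.rpow_neg hR0.le, Real.inv_rpow hR0.le,
    Real.inv_rpow hR0.le, two_mul, Real.rpow_add hR0]
  have : 0 < R ^ ε := Real.rpow_pos_of_pos hR0 _
  field_simp

/-! ### Dyadic sums -/

theorem summable_pow_natAbs {q : ℝ} (h0 : 0 ≤ q) (h1 : q < 1) :
    Summable fun k : ℤ => q ^ k.natAbs := by
  refine Summable.of_nat_of_neg ?_ ?_ <;> simpa using summable_geometric_of_lt_one h0 h1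

/-- Geometric decay of `2^{jτ} (1 + t 2^j)⁻³` away from the index `n` with `2^n ≤ 1 / t < 2^{n+1}`. -/
theorem dyadic_term_le {ε τ t : ℝ} (hε : 0 < ε) (hε1 : ε ≤ 1) (hετ : ε ≤ τ) (hτ : τ ≤ 2)
    (ht : 0 < t) {n : ℤ} (hn : (2 : ℝ) ^ n ≤ t⁻¹) (hn' : t⁻¹ < 2 ^ (n + 1)) (j : ℤ) :
    ((2 : ℝ) ^ j) ^ τ / (1 + t * 2 ^ j) ^ 3
      ≤ 2 * t ^ (-τ) * ((2 : ℝ) ^ (-ε)) ^ (j - n).natAbs := by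
  set y : ℝ := t * 2 ^ j with hy
  have hj : (0 : ℝ) < 2 ^ j := by positivity
  have hy0 : 0 < y := by positivity
  have h1 : ((2 : ℝ) ^ j) ^ τ = t ^ (-τ) * y ^ τ := by
    rw [hy, Real.mul_rpow ht.le hj.le, ← mul_assoc, ← Real.rpow_add ht]
    simp
  have htτ : 0 < t ^ (-τ) := Real.rpow_pos_of_pos ht _
  suffices h : y ^ τ / (1 + y) ^ 3 ≤ 2 * ((2 : ℝ) ^ (-ε)) ^ (j - n).natAbs by
    rw [h1, mul_div_assoc, mul_comm 2, mul_assoc]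
    gcongr
  have hpow : ((2 : ℝ) ^ (-ε)) ^ (j - n).natAbs = (2 : ℝ) ^ (-ε * |((j - n : ℤ) : ℝ)|) := by
    rw [← Real.rpow_natCast, ← Real.rpow_mul (by norm_num), Nat.cast_natAbs, Int.cast_abs]
  rw [hpow]
  rcases le_or_gt j n with hjn | hjn
  · have hy1 : y ≤ 2 ^ (j - n) := by
      rw [zpow_sub₀ two_ne_zero, hy, le_div_iff₀ (by positivity)]
      have : t * 2 ^ n ≤ 1 := by
        calc t * 2 ^ n ≤ t * t⁻¹ := by gcongr
          _ = 1 := mul_inv_cancel₀ ht.ne'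
      nlinarith
    have hy2 : y ≤ 1 := hy1.trans (zpow_le_one_of_nonpos₀ (by norm_num) (by omega))
    have h2 : y ^ τ ≤ (2 : ℝ) ^ (-ε * |((j - n : ℤ) : ℝ)|) := by
      calc y ^ τ ≤ y ^ ε := Real.rpow_le_rpow_of_exponent_ge hy0 hy2 hετ
        _ ≤ ((2 : ℝ) ^ (j - n)) ^ ε := Real.rpow_le_rpow hy0.le hy1 hε.le
        _ = _ := by
          rw [← Real.rpow_intCast, ← Real.rpow_mul (by norm_num), abs_of_nonpos]
          · congr 1; ring
          · exact_mod_cast (by omega : j - n ≤ 0)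
    have h3 : (0 : ℝ) < (2 : ℝ) ^ (-ε * |((j - n : ℤ) : ℝ)|) := by positivity
    calc y ^ τ / (1 + y) ^ 3 ≤ y ^ τ := div_le_self (by positivity) (one_le_pow₀ (by linarith))
      _ ≤ _ := by linarith
  · have hy1 : 2 ^ (j - n) ≤ 2 * y := by
      rw [zpow_sub₀ two_ne_zero, hy, div_le_iff₀ (by positivity)]
      have : 1 ≤ t * 2 ^ (n + 1) := by
        calc 1 = t * t⁻¹ := (mul_inv_cancel₀ ht.ne').symm
          _ ≤ _ := by gcongr
      rw [zpow_add₀ two_ne_zero, zpow_one] at this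
      nlinarith
    have h2 : y ^ τ ≤ (1 + y) ^ 2 := by
      calc y ^ τ ≤ (1 + y) ^ τ :=
            Real.rpow_le_rpow hy0.le (by linarith) (hε.le.trans hετ)
        _ ≤ (1 + y) ^ (2 : ℝ) := Real.rpow_le_rpow_of_exponent_le (by linarith) hτ
        _ = _ := by norm_cast
    have h3 : (2 : ℝ) * (2 ^ (j - n))⁻¹ ≤ 2 * (2 : ℝ) ^ (-ε * |((j - n : ℤ) : ℝ)|) := by
      rw [← zpow_neg, ← Real.rpow_intCast]
      gcongr
      · norm_num
      · rw [abs_of_pos (by exact_mod_cast (by omega : 0 < j - n))]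
        have : (0 : ℝ) < ((j - n : ℤ) : ℝ) := by exact_mod_cast (by omega : 0 < j - n)
        push_cast at this ⊢
        nlinarith
    refine le_trans ?_ h3
    calc y ^ τ / (1 + y) ^ 3 ≤ (1 + y) ^ 2 / (1 + y) ^ 3 := by gcongr
      _ = (1 + y)⁻¹ := by field_simp
      _ ≤ y⁻¹ := by gcongr; linarith
      _ ≤ 2 * (2 ^ (j - n))⁻¹ := by
        rw [← div_eq_mul_inv, le_div_iff₀ (by positivity), inv_mul_le_iff₀ hy0]
        linarith

/-- The sum `∑_j 2^{jτ} (1 + t 2^j)^{-3}` is dominated by its terms with `2^j` comparable to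
`1 / t`. -/
theorem exists_dyadic_sum_le {ε : ℝ} (hε : 0 < ε) (hε1 : ε ≤ 1) :
    ∃ K : ℝ, 0 < K ∧ ∀ τ t : ℝ, ε ≤ τ → τ ≤ 2 → 0 < t →
      Summable (fun j : ℤ => ((2 : ℝ) ^ j) ^ τ / (1 + t * 2 ^ j) ^ 3) ∧
      ∑' j : ℤ, ((2 : ℝ) ^ j) ^ τ / (1 + t * 2 ^ j) ^ 3 ≤ K * t ^ (-τ) := by
  have hq0 : (0 : ℝ) < 2 ^ (-ε) := by positivity
  have hq1 : (2 : ℝ) ^ (-ε) < 1 := Real.rpow_lt_one_of_one_lt_of_neg (by norm_num) (by linarith)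
  have hs := summable_pow_natAbs hq0.le hq1
  refine ⟨2 * ∑' k : ℤ, ((2 : ℝ) ^ (-ε)) ^ k.natAbs, ?_, fun τ t hετ hτ ht => ?_⟩
  · have : 0 < ∑' k : ℤ, ((2 : ℝ) ^ (-ε)) ^ k.natAbs :=
      hs.tsum_pos (fun k => by positivity) 0 (by positivity)
    positivity
  · obtain ⟨n, hn, hn'⟩ := exists_mem_Ico_zpow (inv_pos.2 ht) (one_lt_two : (1 : ℝ) < 2)
    have hle := dyadic_term_le hε hε1 hετ hτ ht hn hn'
    have hs' : Summable fun j : ℤ => 2 * t ^ (-τ) * ((2 : ℝ) ^ (-ε)) ^ (j - n).natAbs :=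
      ((Equiv.subRight n).summable_iff.2 hs).mul_left _
    have hsum : Summable (fun j : ℤ => ((2 : ℝ) ^ j) ^ τ / (1 + t * 2 ^ j) ^ 3) :=
      Summable.of_nonneg_of_le (fun j => by positivity) hle hs'
    refine ⟨hsum, (hsum.tsum_le_tsum hle hs').trans (le_of_eq ?_)⟩
    have := (Equiv.subRight n).tsum_eq (fun k : ℤ => ((2 : ℝ) ^ (-ε)) ^ k.natAbs)
    simp only [Equiv.subRight_apply] at this
    rw [tsum_mul_left, this]
    ring

/-! ### The Poisson extension as a sum of dyadic blocks -/

theorem exists_isGivenBy_of_bounded {F : ℝ → ℂ} {N : ℝ} (hF : Continuous F)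
    (hN : ∀ x, ‖F x‖ ≤ N) : ∃ u : 𝓢'(ℝ, ℂ), IsGivenBy u F := by
  have hm : MemLp F ⊤ volume :=
    memLp_top_of_bound hF.aestronglyMeasurable N (Filter.Eventually.of_forall hN)
  refine ⟨Lp.toTemperedDistribution (hm.toLp F), fun φ => ⟨?_, ?_⟩⟩
  · exact (φ.integrable (μ := volume)).mul_bdd hF.aestronglyMeasurable
      (Filter.Eventually.of_forall hN)
  · rw [Lp.toTemperedDistribution_apply]
    refine integral_congr_ae ?_
    filter_upwards [hm.coeFn_toLp] with x hx
    rw [hx, smul_eq_mul]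

/-- A smooth cutoff, supported away from `0` and `∞`, equal to `1` on the support of `ϕ`. -/
theorem exists_cutoff {ϕ : ℝ → ℂ} (hc : HasCompactSupport ϕ) (h0 : (0 : ℝ) ∉ tsupport ϕ) :
    ∃ χ : ℝ → ℂ, ContDiff ℝ ∞ χ ∧ HasCompactSupport χ ∧ (0 : ℝ) ∉ tsupport χ ∧
      ∀ ξ, ϕ ξ ≠ 0 → χ ξ = 1 := by
  obtain ⟨A', hA', hsupp'⟩ := exists_annulus hc h0
  obtain ⟨A, hA, hsupp⟩ : ∃ A : ℝ, 1 < A ∧ ∀ ξ, ϕ ξ ≠ 0 → A⁻¹ ≤ |ξ| ∧ |ξ| ≤ A := by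
    refine ⟨A' + 1, by linarith, fun ξ hξ => ?_⟩
    obtain ⟨h1, h2⟩ := hsupp' ξ (subset_tsupport _ hξ)
    exact ⟨(inv_anti₀ (by linarith) (by linarith)).trans h1, by linarith⟩
  have hA0 : 0 < A := by linarith
  have hAi : A⁻¹ < 1 := inv_lt_one_of_one_lt₀ hA
  have hAi0 : 0 < A⁻¹ := inv_pos.2 hA0
  -- A bump in the variable `ξ ^ 2`, equal to `1` on `[A⁻², A²]`.
  let f : ContDiffBump ((A ^ 2 + A⁻¹ ^ 2) / 2) :=
    ⟨(A ^ 2 - A⁻¹ ^ 2) / 2, A ^ 2 / 2, by nlinarith, by nlinarith⟩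
  have hsub : tsupport (fun ξ : ℝ => (f (ξ ^ 2) : ℂ))
      ⊆ {ξ : ℝ | |ξ ^ 2 - (A ^ 2 + A⁻¹ ^ 2) / 2| ≤ A ^ 2 / 2} := by
    refine closure_minimal (fun ξ hξ => ?_) (isClosed_le (by fun_prop) continuous_const)
    by_contra hlt
    refine hξ ?_
    have := f.zero_of_le_dist (x := ξ ^ 2) (by rw [Real.dist_eq]; exact (not_le.1 hlt).le)
    simp [this]
  refine ⟨fun ξ => (f (ξ ^ 2) : ℂ), ?_, ?_, ?_, ?_⟩
  · exact Complex.ofRealCLM.contDiff.comp (f.contDiff.comp (contDiff_id.pow 2))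
  · refine HasCompactSupport.of_support_subset_isCompact (isCompact_Icc (a := -(2 * A)) (b := 2 * A))
      fun ξ hξ => ?_
    have h1 : |ξ ^ 2 - (A ^ 2 + A⁻¹ ^ 2) / 2| ≤ A ^ 2 / 2 := hsub (subset_tsupport _ hξ)
    have h2 := (abs_le.1 h1).2
    exact abs_le.1 (abs_le_of_sq_le_sq (by nlinarith) (by positivity))
  · intro h
    have h1 : |(0 : ℝ) ^ 2 - (A ^ 2 + A⁻¹ ^ 2) / 2| ≤ A ^ 2 / 2 := hsub h
    have h2 := (abs_le.1 h1).1
    nlinarith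
  · intro ξ hξ
    obtain ⟨h1, h2⟩ := hsupp ξ hξ
    have h3 : A⁻¹ ^ 2 ≤ ξ ^ 2 := by rw [← sq_abs ξ]; gcongr
    have h4 : ξ ^ 2 ≤ A ^ 2 := by rw [← sq_abs ξ]; gcongr
    have : f (ξ ^ 2) = 1 := f.one_of_mem_closedBall (by
      rw [Metric.mem_closedBall, Real.dist_eq]
      exact abs_le.2 ⟨by simp only [f]; linarith, by simp only [f]; linarith⟩)
    simp [this]

/-- Two annuli, one of them dilated by `2^j`, meet for finitely many `j` only. -/
theorem exists_finset_annuli {ϕ η : ℝ → ℂ} (hϕc : HasCompactSupport ϕ) (hϕ0 : (0 : ℝ) ∉ tsupport ϕ)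
    (hηc : HasCompactSupport η) (hη0 : (0 : ℝ) ∉ tsupport η) :
    ∃ s : Finset ℤ, ∀ j ∉ s, ∀ ξ, η ξ ≠ 0 → ϕ ((2 : ℝ) ^ (-j) * ξ) = 0 := by
  obtain ⟨A, hA, hϕA⟩ := exists_annulus hϕc hϕ0
  obtain ⟨A', hA', hηA⟩ := exists_annulus hηc hη0
  obtain ⟨N, hN⟩ := pow_unbounded_of_one_lt (A * A') (one_lt_two : (1 : ℝ) < 2)
  have hA0 : 0 < A := by linarith
  refine ⟨Finset.Icc (-(N : ℤ)) N, fun j hj ξ hξ => ?_⟩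
  by_contra hne
  obtain ⟨h1, h2⟩ := hϕA _ (subset_tsupport _ hne)
  obtain ⟨h3, h4⟩ := hηA _ (subset_tsupport _ hξ)
  have hpos : (0 : ℝ) < 2 ^ (-j) := by positivity
  rw [abs_mul, abs_of_pos hpos] at h1 h2
  have hbig : ∀ k : ℤ, (N : ℤ) < k → A * A' < (2 : ℝ) ^ k := by
    intro k hk
    refine hN.trans ?_
    rw [← zpow_natCast]
    exact zpow_lt_zpow_right₀ one_lt_two hk
  rw [Finset.mem_Icc, not_and_or, not_le, not_le] at hj
  rcases hj with hj | hj
  · have h5 := hbig (-j) (by omega)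
    rw [inv_le_iff_one_le_mul₀ (by linarith)] at h3
    nlinarith
  · have h5 := hbig j hj
    have h6 : (2 : ℝ) ^ (-j) * 2 ^ j = 1 := by rw [← zpow_add₀ two_ne_zero]; simp
    rw [inv_le_iff_one_le_mul₀ hA0] at h1
    have h7 : (2 : ℝ) ^ (-j) * (A * A') < 1 := by rw [← h6]; gcongr
    have h8 : 2 ^ (-j) * |ξ| ≤ 2 ^ (-j) * A' := by gcongr
    nlinarith

/-- The series of blocks solves the multiplier equation of `Λ^σ (K(t,·) ∗ h)`: tested against a
frequency cutoff it reduces to finitely many blocks. -/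
theorem isFracPoisson_tsum {ϕ : ℝ → ℝ} (hϕ : IsLittlewoodPaley ϕ) {χ : ℝ → ℂ}
    (hχ : ∀ ξ, (ϕ ξ : ℂ) ≠ 0 → χ ξ = 1) {σ t : ℝ} {h : 𝓢'(ℝ, ℂ)} {n : ℤ → 𝓢(ℝ, ℂ)}
    (hn : ∀ j ξ, n j ξ = χ (((2 : ℝ) ^ j)⁻¹ * ξ) * (poissonSymbol σ t ξ : ℂ)) {f : ℤ → ℝ → ℂ}
    (hf : ∀ j, IsGivenBy (TemperedDistribution.fourierMultiplierCLM ℂ (n j) (dyadicBlock ϕ j h))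
      (f j)) (hfc : ∀ j, Continuous (f j)) {w : ℤ → ℝ} (hw : Summable w)
    (hfw : ∀ j x, ‖f j x‖ ≤ w j) : IsFracPoisson σ t h (fun x => ∑' j, f j x) := by
  have hcont : Continuous fun x => ∑' j, f j x := continuous_tsum hfc hw hfw
  obtain ⟨u, hu⟩ := exists_isGivenBy_of_bounded hcont
    (fun x => tsum_of_norm_bounded hw.hasSum (fun j => hfw j x))
  refine ⟨u, hu, fun η hη hηc hη0 => ?_⟩
  obtain ⟨s, hs⟩ := exists_finset_annuli hϕ.hasCompactSupport_ofReal hϕ.zero_notMem_ofReal hηc hη0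
  have hηt : η.HasTemperateGrowth := hηc.hasTemperateGrowth hη
  have hϕt : ∀ j : ℤ, (fun ξ : ℝ => (ϕ ((2 : ℝ) ^ (-j) * ξ) : ℂ)).HasTemperateGrowth := by
    intro j
    refine HasCompactSupport.hasTemperateGrowth ?_ ?_
    · simpa using hasCompactSupport_scaled hϕ.hasCompactSupport_ofReal
        (zpow_ne_zero (-j) (two_ne_zero : (2 : ℝ) ≠ 0)) (fun _ => 1)
    · exact hϕ.contDiff_ofReal.comp (contDiff_const.mul contDiff_id)
  let m : ℤ → ℝ → ℂ := fun j => ((fun ξ : ℝ => (ϕ ((2 : ℝ) ^ (-j) * ξ) : ℂ)) * ⇑(n j)) * η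
  have hmt : ∀ j, (m j).HasTemperateGrowth := fun j =>
    ((hϕt j).mul (n j).hasTemperateGrowth).mul hηt
  have hm : ∀ j ξ, m j ξ = (ϕ ((2 : ℝ) ^ (-j) * ξ) : ℂ) * (η ξ * (poissonSymbol σ t ξ : ℂ)) := by
    intro j ξ
    simp only [m, Pi.mul_apply, hn]
    by_cases h0 : (ϕ ((2 : ℝ) ^ (-j) * ξ) : ℂ) = 0
    · rw [h0, zero_mul, zero_mul, zero_mul]
    · have := hχ _ h0
      rw [zpow_neg] at this
      rw [this]; ring
  have hm0 : ∀ j ∉ s, m j = fun _ => 0 := by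
    intro j hj
    ext ξ
    rw [hm]
    by_cases h0 : η ξ = 0
    · simp [h0]
    · rw [hs j hj ξ h0, zero_mul]
  have hsumm : (fun ξ => η ξ * (poissonSymbol σ t ξ : ℂ)) = fun ξ => ∑ j ∈ s, m j ξ := by
    ext ξ
    simp only [hm, ← Finset.sum_mul]
    by_cases h0 : η ξ = 0
    · simp [h0]
    · have hξ : ξ ≠ 0 := by
        rintro rfl
        exact h0 (image_eq_zero_of_notMem_tsupport hη0)
      have h1 : ∑ j ∈ s, ϕ ((2 : ℝ) ^ (-j) * ξ) = 1 :=
        (hasSum_sum_of_ne_finset_zero fun j hj => by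
          simpa using hs j hj ξ h0).unique (hϕ.hasSum_one ξ hξ)
      rw [← Complex.ofReal_sum, h1, Complex.ofReal_one, one_mul]
  rw [hsumm, TemperedDistribution.fourierMultiplierCLM_sum ℂ (fun j _ => hmt j)]
  ext φ
  set ψ : 𝓢(ℝ, ℂ) := 𝓕 (SchwartzMap.smulLeftCLM ℂ η (𝓕⁻ φ)) with hψ
  have hterm : ∀ j, ∫ x, ψ x * f j x = TemperedDistribution.fourierMultiplierCLM ℂ (m j) h φ := by
    intro j
    rw [← ((hf j) ψ).2, hψ, ← TemperedDistribution.fourierMultiplierCLM_apply_apply, dyadicBlock,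
      TemperedDistribution.fourierMultiplierCLM_fourierMultiplierCLM_apply (hϕt j)
        (n j).hasTemperateGrowth,
      TemperedDistribution.fourierMultiplierCLM_fourierMultiplierCLM_apply
        ((hϕt j).mul (n j).hasTemperateGrowth) hηt]
  have hsumint : HasSum (fun j => ∫ x, ψ x * f j x) (∫ x, ∑' j, ψ x * f j x) := by
    refine hasSum_integral_of_summable_integral_norm (fun j => ((hf j) ψ).1) ?_
    refine Summable.of_nonneg_of_le (fun j => integral_nonneg fun x => norm_nonneg _) (fun j => ?_)
      (hw.mul_left (∫ x, ‖ψ x‖))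
    rw [← integral_mul_const]
    refine integral_mono ((hf j) ψ).1.norm ((ψ.integrable (μ := volume)).norm.mul_const _)
      fun x => ?_
    rw [norm_mul]
    gcongr
    exact hfw j x
  have hfin : HasSum (fun j => ∫ x, ψ x * f j x)
      (∑ j ∈ s, TemperedDistribution.fourierMultiplierCLM ℂ (m j) h φ) := by
    simp only [hterm]
    refine hasSum_sum_of_ne_finset_zero fun j hj => ?_
    rw [hm0 j hj]
    simp
  rw [TemperedDistribution.fourierMultiplierCLM_apply_apply, (hu _).2]
  simp only [← hψ, ← tsum_mul_left]
  rw [hsumint.unique hfin]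
  simp

/-- For `h` in the Besov space, `Λ^σ (K(t,·) ∗ h)` has a bounded representative whose increments
are of size `min(t^{-σ}, |α| t^{-σ-1})`. -/
theorem exists_isFracPoisson_increment_le {ϕ : ℝ → ℝ} (hϕ : IsLittlewoodPaley ϕ) {ε : ℝ}
    (hε : 0 < ε) (hε1 : ε ≤ 1) :
    ∃ C : ℝ, 0 < C ∧ ∀ (h : 𝓢'(ℝ, ℂ)) (B : ℝ), 0 ≤ B →
      (∀ j, supNorm (dyadicBlock ϕ j h) < ENNReal.ofReal B) →
      ∀ σ t : ℝ, ε ≤ σ → σ ≤ 1 → 0 < t → ∃ F : ℝ → ℂ, IsFracPoisson σ t h F ∧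
        ∀ α x, ‖increment α F x‖ ≤ C * B * t ^ (-σ) ∧
          ‖increment α F x‖ ≤ C * B * (|α| * t ^ (-(σ + 1))) := by
  obtain ⟨χ, hχs, hχc, hχ0, hχ⟩ := exists_cutoff hϕ.hasCompactSupport_ofReal hϕ.zero_notMem_ofReal
  obtain ⟨D, hD, hker⟩ := exists_scaled_kernel hχs hχc hχ0
  obtain ⟨K, hK, hsum⟩ := exists_dyadic_sum_le hε hε1
  have hpi := Real.pi_pos
  refine ⟨3 * (Real.pi * D) * K, by positivity, fun h B hB hblock σ t hεσ hσ ht => ?_⟩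
  have hg : ∀ j, ∃ g : ℝ → ℂ, IsGivenBy (dyadicBlock ϕ j h) g ∧ ∀ᵐ x, ‖g x‖ ≤ B := by
    intro j
    obtain ⟨g, hg, hlt⟩ := by simpa only [supNorm, iInf_lt_iff] using hblock j
    refine ⟨g, hg, ?_⟩
    filter_upwards [ae_norm_le_of_eLpNorm_top (hlt.trans_le le_top).ne] with x hx
    refine hx.trans ?_
    have := ENNReal.toReal_mono ENNReal.ofReal_ne_top hlt.le
    rwa [ENNReal.toReal_ofReal hB] at this
  choose g hg hgB using hg
  have hR : ∀ j : ℤ, (0 : ℝ) < 2 ^ j := fun j => by positivity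
  have hn := fun j : ℤ => hker σ t (2 ^ j) (abs_le.2 ⟨by linarith, hσ⟩) (hR j)
    (by have := mul_pos ht (hR j); linarith)
  choose n hnsymb hnk hnk' using hn
  set w : ℤ → ℝ := fun j => ((2 : ℝ) ^ j) ^ σ / (1 + t * 2 ^ j) ^ 3 with hw
  have habs : ∀ j : ℤ, |t * 2 ^ j| = t * 2 ^ j := fun j => abs_of_pos (mul_pos ht (hR j))
  simp only [habs] at hnk hnk'
  have hw0 : ∀ j, 0 ≤ w j := fun j => by
    have := hR j
    positivity
  obtain ⟨hws, hwK⟩ := hsum σ t hεσ (by linarith) ht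
  obtain ⟨hws', hwK'⟩ := hsum (σ + 1) t (by linarith) (by linarith) ht
  have hwR : ∀ j : ℤ, ((2 : ℝ) ^ j) ^ (σ + 1) / (1 + t * 2 ^ j) ^ 3 = w j * 2 ^ j := by
    intro j
    rw [Real.rpow_add_one (hR j).ne']
    simp only [hw]; ring
  simp only [hwR] at hws' hwK'
  let f : ℤ → ℝ → ℂ := fun j => kernelConv (𝓕⁻ (n j) : 𝓢(ℝ, ℂ)) (g j)
  have hfb : ∀ j x, ‖f j x‖ ≤ Real.pi * D * B * w j := by
    intro j x
    refine (norm_kernelConv_le (hR j) (mul_nonneg hD.le (hw0 j)) (hnk j) (hgB j) x).trans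
      (le_of_eq (by ring))
  have hfd : ∀ j α x, ‖f j x - f j (x - α)‖ ≤ 3 * (Real.pi * D) * B * |α| * (w j * 2 ^ j) := by
    intro j α x
    refine (norm_kernelConv_sub_le (hR j) (mul_nonneg hD.le (hw0 j)) hB
      (𝓕⁻ (n j) : 𝓢(ℝ, ℂ)).differentiable (hnk j) (hnk' j) (hg j).aestronglyMeasurable
      (hgB j) α x).trans (le_of_eq (by ring))
  have hfc : ∀ j, Continuous (f j) := by
    intro j
    refine (LipschitzWith.of_dist_le' (K := 3 * (Real.pi * D) * B * (w j * 2 ^ j))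
      fun x y => ?_).continuous
    have := hfd j (x - y) x
    rw [sub_sub_cancel] at this
    rw [dist_eq_norm, dist_eq_norm, Real.norm_eq_abs]
    exact this.trans (le_of_eq (by ring))
  have hws1 : Summable fun j => Real.pi * D * B * w j := hws.mul_left _
  have hfsum : ∀ x, Summable fun j => f j x := fun x =>
    Summable.of_norm_bounded hws1 fun j => hfb j x
  refine ⟨fun x => ∑' j, f j x, isFracPoisson_tsum hϕ hχ hnsymb
    (fun j => (hg j).fourierMultiplier (hgB j) (n j)) hfc hws1 hfb, fun α x => ⟨?_, ?_⟩⟩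
  · have hF : ∀ x, ‖∑' j, f j x‖ ≤ Real.pi * D * B * (K * t ^ (-σ)) := by
      intro x
      refine (tsum_of_norm_bounded hws1.hasSum fun j => hfb j x).trans ?_
      rw [tsum_mul_left]
      gcongr
    have h0 : 0 ≤ Real.pi * D * B * (K * t ^ (-σ)) := by positivity
    refine (norm_sub_le _ _).trans ?_
    linarith [hF x, hF (x - α)]
  · have heq : increment α (fun x => ∑' j, f j x) x = ∑' j, (f j x - f j (x - α)) :=
      ((hfsum x).tsum_sub (hfsum (x - α))).symm
    rw [heq]
    refine (tsum_of_norm_bounded (hws'.mul_left _).hasSum fun j => hfd j α x).trans ?_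
    rw [tsum_mul_left]
    calc _ ≤ 3 * (Real.pi * D) * B * |α| * (K * t ^ (-(σ + 1))) := by gcongr
      _ = _ := by ring

/-! ### The mixed norm in time -/

theorem lintegral_Ioc_rpow {a p : ℝ} (ha : 0 < a) (hp : 0 < p) :
    ∫⁻ t in Ioc 0 a, ENNReal.ofReal (t ^ (p - 1)) = ENNReal.ofReal (a ^ p / p) := by
  have hi : IntegrableOn (fun t : ℝ => t ^ (p - 1)) (Ioc 0 a) :=
    (intervalIntegrable_iff_integrableOn_Ioc_of_le ha.le).1
      (intervalIntegral.intervalIntegrable_rpow' (by linarith))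
  rw [← ofReal_integral_eq_lintegral_ofReal hi, ← intervalIntegral.integral_of_le ha.le,
    integral_rpow (Or.inl (by linarith))]
  · rw [sub_add_cancel, Real.zero_rpow hp.ne', sub_zero]
  · exact (ae_restrict_iff' measurableSet_Ioc).2
      (Filter.Eventually.of_forall fun t ht => Real.rpow_nonneg ht.1.le _)

theorem lintegral_Ioi_rpow {a r : ℝ} (ha : 0 < a) (hr : 0 < r) :
    ∫⁻ t in Ioi a, ENNReal.ofReal (t ^ (-r - 1)) = ENNReal.ofReal (a ^ (-r) / r) := by
  rw [← ofReal_integral_eq_lintegral_ofReal (integrableOn_Ioi_rpow_of_lt (by linarith) ha),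
    integral_Ioi_rpow_of_lt (by linarith) ha]
  · rw [sub_add_cancel, neg_div_neg_eq]
  · exact (ae_restrict_iff' measurableSet_Ioi).2
      (Filter.Eventually.of_forall fun t ht => Real.rpow_nonneg (ha.trans ht).le _)

/-- The decay `min(t^{-σ}, |α| t^{-σ-1})` with `σ = b - ε` of the increments is of order
`|α|^{μ+ε}` in the mixed norm: the two regimes meet at `t = |α|`. -/
theorem mixedNorm_le {ε μ b N : ℝ} (hε : 0 < ε) (hμ : 0 ≤ μ) (hb : 0 < b)
    (hb1 : b ≤ 1) (hμε : ε ≤ 1 - μ - ε) (hN : 0 ≤ N) {F : ℝ → ℝ → ℂ}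
    (hF : ∀ t, 0 < t → ∀ α x, ‖increment α (F t) x‖ ≤ N * t ^ (-(b - ε)) ∧
      ‖increment α (F t) x‖ ≤ N * (|α| * t ^ (-((b - ε) + 1)))) {α : ℝ} (hα : α ≠ 0) :
    mixedNorm μ b α F ≤ ENNReal.ofReal (N * (2 / ε)) * ENNReal.ofReal (|α| ^ (μ + ε)) := by
  set a := |α| with ha
  have ha0 : 0 < a := abs_pos.2 hα
  set p := (μ + ε) / b with hp
  set r := (1 - μ - ε) / b with hr
  have hp0 : 0 < p := by positivity
  have hr0 : 0 < r := div_pos (by linarith) hb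
  have hb' : 0 ≤ 1 / b := by positivity
  have hcommon : ∀ t M : ℝ, 0 < t → 0 ≤ M → (∀ x, ‖increment α (F t) x‖ ≤ M) →
      (ENNReal.ofReal (t ^ μ) * eLpNorm (increment α (F t)) ⊤ volume) ^ (1 / b)
        ≤ ENNReal.ofReal ((t ^ μ * M) ^ (1 / b)) := by
    intro t M ht hM hbd
    have htμ : 0 ≤ t ^ μ := Real.rpow_nonneg ht.le _
    rw [← ENNReal.ofReal_rpow_of_nonneg (mul_nonneg htμ hM) hb', ENNReal.ofReal_mul htμ]
    gcongr
    rw [eLpNorm_exponent_top]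
    exact eLpNormEssSup_le_of_ae_bound (Filter.Eventually.of_forall hbd)
  have hsmall : ∀ t ∈ Ioc 0 a,
      (ENNReal.ofReal (t ^ μ) * eLpNorm (increment α (F t)) ⊤ volume) ^ (1 / b)
        ≤ ENNReal.ofReal (N ^ (1 / b)) * ENNReal.ofReal (t ^ (p - 1)) := by
    intro t ht
    have ht0 : 0 < t := ht.1
    refine (hcommon t _ ht0 (by positivity) fun x => (hF t ht0 α x).1).trans (le_of_eq ?_)
    rw [← ENNReal.ofReal_mul (by positivity), mul_left_comm, ← Real.rpow_add ht0,
      Real.mul_rpow hN (by positivity), ← Real.rpow_mul ht0.le]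
    congr 3
    rw [hp]; field_simp; ring
  have hlarge : ∀ t ∈ Ioi a,
      (ENNReal.ofReal (t ^ μ) * eLpNorm (increment α (F t)) ⊤ volume) ^ (1 / b)
        ≤ ENNReal.ofReal (N ^ (1 / b) * a ^ (1 / b)) * ENNReal.ofReal (t ^ (-r - 1)) := by
    intro t ht
    have ht0 : 0 < t := ha0.trans ht
    refine (hcommon t _ ht0 (by positivity) fun x => (hF t ht0 α x).2).trans (le_of_eq ?_)
    rw [← ENNReal.ofReal_mul (by positivity), ← ha,
      show t ^ μ * (N * (a * t ^ (-((b - ε) + 1)))) = N * (a * (t ^ μ * t ^ (-((b - ε) + 1)))) by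
        ring, ← Real.rpow_add ht0, Real.mul_rpow hN (by positivity), Real.mul_rpow ha0.le (by positivity),
      ← Real.rpow_mul ht0.le, mul_assoc]
    congr 4
    rw [hr]; field_simp; ring
  have hint : ∫⁻ t in Ioi (0 : ℝ),
      (ENNReal.ofReal (t ^ μ) * eLpNorm (increment α (F t)) ⊤ volume) ^ (1 / b)
      ≤ ENNReal.ofReal (N ^ (1 / b) * a ^ p * (2 / ε)) := by
    rw [← Ioc_union_Ioi_eq_Ioi ha0.le]
    refine (lintegral_union_le _ _ _).trans ?_
    refine (add_le_add (setLIntegral_mono' measurableSet_Ioc hsmall)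
      (setLIntegral_mono' measurableSet_Ioi hlarge)).trans ?_
    rw [lintegral_const_mul' _ _ ENNReal.ofReal_ne_top,
      lintegral_const_mul' _ _ ENNReal.ofReal_ne_top, lintegral_Ioc_rpow ha0 hp0,
      lintegral_Ioi_rpow ha0 hr0, ← ENNReal.ofReal_mul (by positivity),
      ← ENNReal.ofReal_mul (by positivity), ← ENNReal.ofReal_add (by positivity) (by positivity)]
    refine ENNReal.ofReal_le_ofReal ?_
    have h1 : a ^ (1 / b) * a ^ (-r) = a ^ p := by
      rw [← Real.rpow_add ha0]
      congr 1
      rw [hr, hp]; field_simp; ring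
    have h2 : 1 / p ≤ 1 / ε := by
      rw [hp, one_div_div, div_le_div_iff₀ (by positivity) hε]
      nlinarith
    have h3 : 1 / r ≤ 1 / ε := by
      rw [hr, one_div_div, div_le_div_iff₀ (by linarith) hε]
      nlinarith
    calc N ^ (1 / b) * (a ^ p / p) + N ^ (1 / b) * a ^ (1 / b) * (a ^ (-r) / r)
        = N ^ (1 / b) * a ^ p * (1 / p) + N ^ (1 / b) * (a ^ (1 / b) * a ^ (-r)) * (1 / r) := by
          ring
      _ ≤ N ^ (1 / b) * a ^ p * (1 / ε) + N ^ (1 / b) * a ^ p * (1 / ε) := by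
          rw [h1]; gcongr
      _ = _ := by ring
  refine (ENNReal.rpow_le_rpow hint hb.le).trans ?_
  rw [ENNReal.ofReal_rpow_of_nonneg (by positivity) hb.le, ← ENNReal.ofReal_mul (by positivity)]
  refine ENNReal.ofReal_le_ofReal ?_
  rw [Real.mul_rpow (by positivity) (by positivity), Real.mul_rpow (by positivity) (by positivity),
    ← Real.rpow_mul hN, ← Real.rpow_mul ha0.le, one_div_mul_cancel hb.ne', Real.rpow_one,
    hp, div_mul_cancel₀ _ hb.ne', mul_right_comm]
  gcongr
  have : 1 ≤ 2 / ε := by rw [le_div_iff₀ hε]; linarith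
  calc (2 / ε) ^ b ≤ (2 / ε) ^ (1 : ℝ) := Real.rpow_le_rpow_of_exponent_le this hb1
    _ = _ := Real.rpow_one _

/-- The bound is uniform in `(μ, b)`, since `ε ≤ μ + ε ≤ 1 - ε` and `ε ≤ b - ε ≤ 1` on the index set. -/
theorem exists_tildeGNormRep_le {ϕ : ℝ → ℝ} (hϕ : IsLittlewoodPaley ϕ) {θ ε : ℝ} (hε : 0 < ε)
    (hεθ : 3 * ε ≤ θ) (hθ : θ < 1) : ∃ C : ℝ≥0, 0 < C ∧ ∀ h : 𝓢'(ℝ, ℂ),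
      tildeGNormRep θ ε h ≤ C * besovNormRep ϕ h := by
  have hε1 : ε ≤ 1 := by linarith
  obtain ⟨C, hC, hmain⟩ := exists_isFracPoisson_increment_le hϕ hε hε1
  have hC' : 0 < C * (2 / ε) := by positivity
  refine ⟨(C * (2 / ε)).toNNReal, Real.toNNReal_pos.2 hC', fun h => ?_⟩
  change _ ≤ ENNReal.ofReal (C * (2 / ε)) * _
  rw [← ENNReal.div_le_iff' (by simpa using hC') ENNReal.ofReal_ne_top]
  refine le_of_forall_gt_imp_ge_of_dense fun B' hB' => ?_
  rcases eq_or_ne B' ⊤ with rfl | hBtop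
  · exact le_top
  rw [ENNReal.div_le_iff' (by simpa using hC') ENNReal.ofReal_ne_top]
  obtain ⟨B, hB, rfl⟩ : ∃ B : ℝ, 0 ≤ B ∧ B' = ENNReal.ofReal B :=
    ⟨B'.toReal, ENNReal.toReal_nonneg, (ENNReal.ofReal_toReal hBtop).symm⟩
  have hblock : ∀ j, supNorm (dyadicBlock ϕ j h) < ENNReal.ofReal B := fun j =>
    (le_iSup (fun j => supNorm (dyadicBlock ϕ j h)) j).trans_lt hB'
  refine iSup_le fun μ => iSup_le fun b => iSup_le fun ⟨hμ, _, hb, hbθ⟩ => ?_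
  have hF : ∀ t : ℝ, ∃ F : ℝ → ℂ, 0 < t → IsFracPoisson (b - ε) t h F ∧
      ∀ α x, ‖increment α F x‖ ≤ C * B * t ^ (-(b - ε)) ∧
        ‖increment α F x‖ ≤ C * B * (|α| * t ^ (-((b - ε) + 1))) := by
    intro t
    by_cases ht : 0 < t
    · obtain ⟨F, hF⟩ := hmain h B hB hblock (b - ε) t (by linarith) (by linarith) ht
      exact ⟨F, fun _ => hF⟩
    · exact ⟨0, fun h => absurd h ht⟩
  choose F hF using hF
  refine (iInf₂_le F fun t ht => (hF t ht).1).trans (iSup₂_le fun α hα => ?_)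
  have hα' : 0 < |α| ^ (μ + ε) := Real.rpow_pos_of_pos (abs_pos.2 hα) _
  rw [ENNReal.div_le_iff (by simpa using hα') ENNReal.ofReal_ne_top]
  refine (mixedNorm_le hε hμ (by linarith) (by linarith) (by linarith) (by positivity)
    (fun t ht => (hF t ht).2) hα).trans (le_of_eq ?_)
  rw [← ENNReal.ofReal_mul hC'.le]
  congr 2
  ring

theorem lemma3p1 (θ ε : ℝ) (hε : 0 < ε) (hεθ : 3 * ε ≤ θ) (hθ : θ < 1)
    (ϕ : ℝ → ℝ) (hϕ : IsLittlewoodPaley ϕ) :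
    tildeG θ ε = besovSpace ϕ ∧
      ∃ C : ℝ≥0, 0 < C ∧ ∀ x : TemperedModPoly,
        tildeGNorm θ ε x ≤ C * besovNorm ϕ x ∧ besovNorm ϕ x ≤ C * tildeGNorm θ ε x := by
  obtain ⟨C₁, hC₁, h₁⟩ := exists_tildeGNormRep_le hϕ hε hεθ hθ
  obtain ⟨C₂, hC₂, h₂⟩ := exists_besovNormRep_le hϕ hε (by linarith)
  have h₂' : ∀ h, besovNormRep ϕ h ≤ C₂ * tildeGNormRep θ ε h := fun h => by
    refine (h₂ h).trans (mul_le_mul_right ?_ _)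
    refine le_iSup₂_of_le 0 (2 * ε) (le_iSup_of_le ⟨le_rfl, by norm_num, le_rfl, by linarith⟩ le_rfl)
  have hquot : ∀ (C : ℝ≥0), 0 < C → ∀ N N' : 𝓢'(ℝ, ℂ) → ℝ≥0∞, (∀ h, N h ≤ C * N' h) →
      ∀ x : TemperedModPoly, (⨅ (h : 𝓢'(ℝ, ℂ)) (_ : polynomialDistributions.mkQ h = x), N h)
        ≤ C * ⨅ (h : 𝓢'(ℝ, ℂ)) (_ : polynomialDistributions.mkQ h = x), N' h := by
    intro C hC N N' hN x
    have hC0 : (C : ℝ≥0∞) ≠ 0 := by exact_mod_cast hC.ne'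
    simp only [ENNReal.mul_iInf_of_ne hC0 ENNReal.coe_ne_top]
    exact iInf₂_mono fun h _ => hN h
  have hle₁ : ∀ x, tildeGNorm θ ε x ≤ C₁ * besovNorm ϕ x := hquot C₁ hC₁ _ _ h₁
  have hle₂ : ∀ x, besovNorm ϕ x ≤ C₂ * tildeGNorm θ ε x := hquot C₂ hC₂ _ _ h₂'
  refine ⟨?_, max C₁ C₂, lt_max_of_lt_left hC₁, fun x => ⟨(hle₁ x).trans ?_, (hle₂ x).trans ?_⟩⟩
  · ext x
    exact ⟨fun hx => (hle₂ x).trans_lt (ENNReal.mul_lt_top ENNReal.coe_lt_top hx),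
      fun hx => (hle₁ x).trans_lt (ENNReal.mul_lt_top ENNReal.coe_lt_top hx)⟩
  · gcongr; exact le_max_left _ _
  · gcongr; exact le_max_right _ _
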